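/- Let $\mathcal{P}_n=\{I,X,Y,Z\}^{\otimes n}$ be the set of $n$-qubit Pauli operators, let $H$ be a Hermitian operator on $n$ qubits and let $\mathcal{U}_\theta(\cdot)=e^{i\theta H}\cdot e^{-i\theta H}$ for $\theta\in\mathbb{R}$. Let $\mathcal{N}(\cdot)=\sum_{i=0}^{K}p_iP_i\cdot P_i$ be Pauli noise: $P_0=I_n$, the $P_i\in\mathcal{P}_n$ are pairwise distinct, and the $p_i>0$ sum to $1$. Put $\mathcal{N}_{P_i}(\cdot)=P_i\cdot P_i$. Let $\mathcal{Q}_H$ be the set of all $Q\in\mathcal{P}_n$ that are proportional to a product of Pauli operators $R\in\mathcal{P}_n$ with $\mathrm{tr}[HR]\neq 0$, and let $\mathcal{Q}_H^{\mathrm{com}}=\{Q\in\mathcal{P}_n : [H,Q]=0\}$. A Clifford error-detection supermap is a map $\Theta$ which, for some number $m\ge 0$ of ancilla qubits and some $(n+m)$-qubit Clifford unitaries $U_{\mathrm E},U_{\mathrm D}$, sends a linear map $\Phi$ on $n$-qubit operators to $$\rho\mapsto\langle 0^m|\,U_{\mathrm D}\,(\Phi\otimes\mathcal{I})\big(U_{\mathrm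 E}(\rho\otimes|0^m\rangle\langle 0^m|)U_{\mathrm E}^\dagger\big)\,U_{\mathrm D}^\dagger\,|0^m\rangle .$$ Say that $\Theta$ detects the noise if $\Theta(\mathcal{N}_{P_i}\circ\mathcal{U}_\theta)=\delta_{i0}\,\mathcal{U}_\theta$ for all $i\in\{0,\dots,K\}$ and all $\theta\in\mathbb{R}$. (1) There is a Clifford error-detection supermap that detects the noise if and only if $\{P_1,\dots,P_K\}\cap\mathcal{Q}_H=\emptyset$. (2) For $Q\in\mathcal{Q}_H^{\mathrm{com}}$ let $\Theta_Q$ be the symmetric channel verification (SCV) gadget of $Q$: the error-detection supermap with one ancilla qubit in which $U_{\mathrm E}$ is a Hadamard gate on the ancilla followed by controlled-$Q$, and $U_{\mathrm D}$ is controlled-$Q^\dagger$ followed by a Hadamard gate on the ancilla. For any $Q_1,\dots,Q_r\in\mathcal{Q}_H^{\mathrm{com}}$ that generate $\mathcal{Q}_H^{\mathrm{com}}$ up to phase, the concatenation $\Theta_{Q_1}\circ\cdots\circ\Theta_{Q_r}$ is a Clifford error-detection supermap, and it detects the noise whenever some Clifford error-detection supermap does. Hence SCV under Pauli symmetry is optimal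 for detection among Clifford error-detection supermaps. -/

import Mathlib

noncomputable section

namespace SCV

open Matrix

/-- Operators on a register of qubits indexed by `ι`, written in the computational basis
`ι → Fin 2`.  The register `ι ⊕ κ` is the juxtaposition of the registers `ι` and `κ`. -/
abbrev Op (ι : Type) : Type := Matrix (ι → Fin 2) (ι → Fin 2) ℂ

/-- Linear maps acting on the operators of a register. -/
abbrev Superop (ι : Type) : Type := Op ι →ₗ[ℂ] Op ι

/-- The tensor product `⨂ i, s i` of single-qubit operators. -/
def localOp {ι : Type} [Fintype ι] (s : ι → Matrix (Fin 2) (Fin 2) ℂ) : Op ι :=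
  Matrix.of fun x y => ∏ i, s i (x i) (y i)

/-- The tensor product `A ⊗ B` on the juxtaposed register. -/
def tensorOp {ι κ : Type} (A : Op ι) (B : Op κ) : Op (ι ⊕ κ) :=
  Matrix.of fun x y =>
    A (fun i => x (Sum.inl i)) (fun i => y (Sum.inl i)) *
      B (fun j => x (Sum.inr j)) (fun j => y (Sum.inr j))

/-- The single-qubit Pauli matrices `I, X, Y, Z`. -/
def pauliMatrix : Fin 4 → Matrix (Fin 2) (Fin 2) ℂ :=
  ![1, !![0, 1; 1, 0], !![0, -Complex.I; Complex.I, 0], !![1, 0; 0, -1]]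

/-- The set `{I, X, Y, Z}^{⊗ ι}` of Pauli operators (without phases). -/
def paulis (ι : Type) [Fintype ι] : Set (Op ι) :=
  {P | ∃ p : ι → Fin 4, P = localOp fun i => pauliMatrix (p i)}

/-- Clifford unitaries: the unitaries that conjugate every Pauli operator to a Pauli operator up
to a sign. -/
def IsClifford {ι : Type} [Fintype ι] [DecidableEq ι] (U : Op ι) : Prop :=
  U ∈ Matrix.unitaryGroup (ι → Fin 2) ℂ ∧
    ∀ P ∈ paulis ι, U * P * Uᴴ ∈ paulis ι ∨ -(U * P * Uᴴ) ∈ paulis ι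

/-- The map `ρ ↦ A ρ A†`. -/
def unitaryChannel {ι : Type} [Fintype ι] [DecidableEq ι] (A : Op ι) : Superop ι where
  toFun ρ := A * ρ * Aᴴ
  map_add' ρ σ := by rw [Matrix.mul_add, Matrix.add_mul]
  map_smul' c ρ := by rw [Matrix.mul_smul, Matrix.smul_mul, RingHom.id_apply]

/-- The map `ρ ↦ P ρ P`, for a Pauli operator `P`. -/
def errorChannel {ι : Type} [Fintype ι] [DecidableEq ι] (P : Op ι) : Superop ι where
  toFun ρ := P * ρ * P
  map_add' ρ σ := by rw [Matrix.mul_add, Matrix.add_mul]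
  map_smul' c ρ := by rw [Matrix.mul_smul, Matrix.smul_mul, RingHom.id_apply]

/-- The map `ρ ↦ ρ ⊗ |0⋯0⟩⟨0⋯0|`, attaching the ancilla register `κ`. -/
def attachAncilla (ι κ : Type) [Fintype κ] : Op ι →ₗ[ℂ] Op (ι ⊕ κ) where
  toFun ρ := tensorOp ρ (localOp fun _ => !![1, 0; 0, 0])
  map_add' ρ σ := by ext x y; simp [tensorOp, add_mul]
  map_smul' c ρ := by ext x y; simp [tensorOp, mul_assoc]

/-- The map `M ↦ ⟨0⋯0| M |0⋯0⟩`, post-selecting the outcome `0⋯0` on the ancilla register `κ`. -/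
def postselectAncilla (ι κ : Type) : Op (ι ⊕ κ) →ₗ[ℂ] Op ι where
  toFun M := Matrix.of fun x y => M (Sum.elim x fun _ => 0) (Sum.elim y fun _ => 0)
  map_add' M N := by ext x y; simp
  map_smul' c M := by ext x y; simp

/-- The map `Φ ⊗ id`, with the identity acting on the operators of the ancilla register `κ`:
`Φ` is applied to every block `⟨a| M |b⟩` of `M`. -/
def tensorId {ι : Type} (κ : Type) (Φ : Superop ι) : Superop (ι ⊕ κ) where
  toFun M := Matrix.of fun x y =>
    Φ (Matrix.of fun s t =>
        M (Sum.elim s fun j => x (Sum.inr j)) (Sum.elim t fun j => y (Sum.inr j)))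
      (fun i => x (Sum.inl i)) (fun i => y (Sum.inl i))
  map_add' M N := by
    ext x y
    simp only [Matrix.add_apply, Matrix.of_apply]
    rw [← Matrix.add_apply, ← map_add]
    rfl
  map_smul' c M := by
    ext x y
    simp only [Matrix.smul_apply, Matrix.of_apply, RingHom.id_apply]
    rw [← Matrix.smul_apply, ← map_smul]
    rfl

/-- The error-detection supermap with encoder `UE`, decoder `UD` and ancilla register `κ`:
`Φ ↦ (ρ ↦ ⟨0⋯0| 𝒰_D ∘ (Φ ⊗ id) ∘ 𝒰_E (ρ ⊗ |0⋯0⟩⟨0⋯0|) |0⋯0⟩)`. -/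
def detectionSupermap {ι κ : Type} [Fintype ι] [DecidableEq ι] [Fintype κ] [DecidableEq κ]
    (UE UD : Op (ι ⊕ κ)) (Φ : Superop ι) : Superop ι :=
  postselectAncilla ι κ ∘ₗ unitaryChannel UD ∘ₗ tensorId κ Φ ∘ₗ unitaryChannel UE ∘ₗ
    attachAncilla ι κ

/-- The error-detection supermaps on `n` qubits, with any number `m` of ancilla qubits, whose
encoder and decoder are `(n + m)`-qubit Clifford unitaries. -/
def IsCliffordDetectionSupermap {n : ℕ} (Θ : Superop (Fin n) → Superop (Fin n)) : Prop :=
  ∃ (m : ℕ) (UE UD : Op (Fin n ⊕ Fin m)),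
    IsClifford UE ∧ IsClifford UD ∧ Θ = detectionSupermap UE UD

/-- The channel `ρ ↦ e^{iθH} ρ e^{-iθH}`. -/
def evolution {n : ℕ} (H : Op (Fin n)) (θ : ℝ) : Superop (Fin n) :=
  unitaryChannel (NormedSpace.exp ((Complex.I * (θ : ℂ)) • H))

/-- The Pauli operators that are proportional to a product of elements of `G`. -/
def generatedPaulis {n : ℕ} (G : Set (Op (Fin n))) : Set (Op (Fin n)) :=
  {Q | Q ∈ paulis (Fin n) ∧
    ∃ (l : List (Op (Fin n))) (c : ℂ), (∀ R ∈ l, R ∈ G) ∧ Q = c • l.prod}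

/-- The Pauli operators with a non-zero coefficient in the Pauli expansion of `H`. -/
def pauliSupport {n : ℕ} (H : Op (Fin n)) : Set (Op (Fin n)) :=
  {Q | Q ∈ paulis (Fin n) ∧ (H * Q).trace ≠ 0}

/-- The set `𝒬_H` of the Pauli operators generated, up to phase, by those in the expansion
of `H`. -/
def pauliSpan {n : ℕ} (H : Op (Fin n)) : Set (Op (Fin n)) :=
  generatedPaulis (pauliSupport H)

/-- The Pauli operators that commute with `H` (the Pauli symmetries of `H`). -/
def pauliSymmetries {n : ℕ} (H : Op (Fin n)) : Set (Op (Fin n)) :=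
  {Q | Q ∈ paulis (Fin n) ∧ H * Q = Q * H}

/-- Pauli noise `ρ ↦ ∑ i, p i • P i ρ P i` with `K` nontrivial errors: pairwise distinct Pauli
operators `P 0 = I, P 1, …, P K`, occurring with non-zero probabilities. -/
structure PauliNoise (n K : ℕ) where
  /-- the probabilities `p i` -/
  prob : Fin (K + 1) → ℝ
  /-- the Pauli operators `P i` -/
  err : Fin (K + 1) → Op (Fin n)
  prob_pos : ∀ i, 0 < prob i
  prob_sum : ∑ i, prob i = 1
  err_mem : ∀ i, err i ∈ paulis (Fin n)
  err_zero : err 0 = 1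
  err_injective : Function.Injective err

/-- The set `{P 1, …, P K}` of the errors that have to be detected. -/
def PauliNoise.errors {n K : ℕ} (N : PauliNoise n K) : Set (Op (Fin n)) :=
  {P | ∃ i, i ≠ 0 ∧ P = N.err i}

/-- `Θ` detects the noise on the Hamiltonian evolution: for every error index `i` and every `θ`,
`Θ` maps `𝒩_{P i} ∘ 𝒰` to `𝒰` if `i = 0`, and to `0` otherwise. -/
def Detects {n K : ℕ} (Θ : Superop (Fin n) → Superop (Fin n)) (H : Op (Fin n))
    (N : PauliNoise n K) : Prop :=
  ∀ (i : Fin (K + 1)) (θ : ℝ),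
    Θ (errorChannel (N.err i) ∘ₗ evolution H θ) = (if i = 0 then (1 : ℂ) else 0) • evolution H θ

/-- The Hadamard gate on the single ancilla qubit. -/
def hadamardAncilla (n : ℕ) : Op (Fin n ⊕ Fin 1) :=
  tensorOp 1 (localOp fun _ => ((Real.sqrt 2 : ℂ))⁻¹ • !![1, 1; 1, -1])

/-- The gate controlled-`Q`, controlled by the single ancilla qubit. -/
def controlledOp {n : ℕ} (Q : Op (Fin n)) : Op (Fin n ⊕ Fin 1) :=
  tensorOp 1 (localOp fun _ => !![1, 0; 0, 0]) + tensorOp Q (localOp fun _ => !![0, 0; 0, 1])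

/-- The symmetric channel verification gadget for one Pauli symmetry `Q`: an ancilla qubit in the
state `|0⟩`, a Hadamard gate, controlled-`Q`, the channel, controlled-`Q†`, a Hadamard gate (the
inverse Fourier transform on one qubit), and post-selection of the ancilla outcome `0`. -/
def scvGadgetOne {n : ℕ} (Q : Op (Fin n)) : Superop (Fin n) → Superop (Fin n) :=
  detectionSupermap (controlledOp Q * hadamardAncilla n) (hadamardAncilla n * controlledOp Qᴴ)

/-- The concatenation `Θ_{Q₁} ∘ ⋯ ∘ Θ_{Qᵣ}` of the gadgets for a list of Pauli symmetries. -/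
def scvGadget {n : ℕ} : List (Op (Fin n)) → Superop (Fin n) → Superop (Fin n)
  | [], Φ => Φ
  | Q :: Qs, Φ => scvGadgetOne Q (scvGadget Qs Φ)

/-- `Qs` lists elements of `S` that generate `S` up to phase. -/
def IsGeneratingList {n : ℕ} (Qs : List (Op (Fin n))) (S : Set (Op (Fin n))) : Prop :=
  (∀ Q ∈ Qs, Q ∈ S) ∧ S ⊆ generatedPaulis {Q | Q ∈ Qs}

end SCV

end

/-!
Everything is reduced to Kraus operators. A supermap with encoder `U_E` and decoder `U_D` sends the
map `ρ ↦ A ρ A†` to `ρ ↦ K(A) ρ K(A)†`, where `K(A) = ⟨0⋯0| U_D (A ⊗ 1) U_E |0⋯0⟩` is the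
`compression` of `A`. The maps `ρ ↦ A ρ B` span all superoperators, so `K` determines the supermap
(`supermap_ext`), and composing supermaps amounts to composing compressions
(`compression_comp`). In particular Clifford error-detection supermaps are closed under composition.

*Detection is possible outside `𝒬_H`.* Up to phases the Pauli operators form a vector space over
`ZMod 2`, in which commutation is a non-degenerate symplectic form and `𝒬_H` contains the span of
the support of `H`. If `P ∉ 𝒬_H`, some linear functional vanishes on this span but not at `P`; the
Pauli operator that represents it is a symmetry of `H` that anticommutes with `P`
(`exists_symmetry_anticommuting`). The gadget of a symmetry `Q` has compression
`A ↦ (A + Q A Q) / 2` (`compression_scvGadgetOne`), which fixes `P e^{iθH}` if `Q` commutes with `P`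
and annihilates it otherwise. Since generators of the symmetries cannot all commute with `P` unless
all symmetries do, the concatenated gadgets detect every error outside `𝒬_H` (`detects_scvGadget`).

*Detection is impossible inside `𝒬_H`.* Suppose that a Clifford supermap preserves the evolution.
Then `e^{-iθH} K(e^{iθH})` is a central unitary for every `θ`. At `θ = 0` this says that `U_D U_E`
acts on the code space `|ψ⟩|0⋯0⟩` as a phase `ω`, so that `K = ω L` with
`L(A) = ⟨0⋯0| U_D (A ⊗ 1) U_D† |0⋯0⟩`. The derivative at `θ = 0` says that `L(H) - H` is a multiple
of the identity. As `U_D` is Clifford, `L` maps each Pauli operator to a multiple of a Pauli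
operator; comparing the number of terms of `L(H)` and of `H`, it annihilates no Pauli operator in
the support of `H` (`compression_ne_zero_of_support`). A Pauli operator that `L` does not annihilate
is decoded to an operator preserving the code space, where `L` is multiplicative, so `L` does not
annihilate products of such operators either (`compression_ne_zero_of_mem_pauliSpan`). Hence an
error in `𝒬_H` is not mapped to zero.
-/

noncomputable section

namespace SCV

open Matrix

-- Instances on the index types are shared by whole sections.
set_option linter.unusedSectionVars false

/-! ### Local operators, tensor products and relabelling of registers -/

section Registers

variable {ι κ : Type}

theorem tensorOp_conjTranspose (A : Op ι) (B : Op κ) : (tensorOp A B)ᴴ = tensorOp Aᴴ Bᴴ := by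
  ext x y
  simp [tensorOp, Matrix.conjTranspose_apply]

theorem tensorOp_add_left (A C : Op ι) (B : Op κ) :
    tensorOp (A + C) B = tensorOp A B + tensorOp C B := by
  ext x y; simp [tensorOp, add_mul]

theorem tensorOp_add_right (A : Op ι) (B D : Op κ) :
    tensorOp A (B + D) = tensorOp A B + tensorOp A D := by
  ext x y; simp [tensorOp, mul_add]

theorem tensorOp_smul_left (c : ℂ) (A : Op ι) (B : Op κ) :
    tensorOp (c • A) B = c • tensorOp A B := by
  ext x y; simp [tensorOp, mul_assoc]

theorem tensorOp_smul_right (c : ℂ) (A : Op ι) (B : Op κ) :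
    tensorOp A (c • B) = c • tensorOp A B := by
  ext x y; simp [tensorOp, mul_left_comm]

variable [Fintype ι] [DecidableEq ι] [Fintype κ] [DecidableEq κ]

theorem localOp_mul (s t : ι → Matrix (Fin 2) (Fin 2) ℂ) :
    localOp s * localOp t = localOp fun i => s i * t i := by
  ext x y
  simp only [localOp, Matrix.mul_apply, Matrix.of_apply, ← Finset.prod_mul_distrib]
  rw [Finset.prod_univ_sum, Fintype.piFinset_univ]

theorem localOp_one : localOp (fun _ : ι => (1 : Matrix (Fin 2) (Fin 2) ℂ)) = 1 := by
  ext x y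
  simp only [localOp, Matrix.of_apply, Matrix.one_apply, Finset.prod_boole, funext_iff,
    Finset.mem_univ, true_imp_iff]

theorem localOp_conjTranspose (s : ι → Matrix (Fin 2) (Fin 2) ℂ) :
    (localOp s)ᴴ = localOp fun i => (s i)ᴴ := by
  ext x y
  simp [localOp, Matrix.conjTranspose_apply]

theorem localOp_smul (c : ι → ℂ) (s : ι → Matrix (Fin 2) (Fin 2) ℂ) :
    localOp (fun i => c i • s i) = (∏ i, c i) • localOp s := by
  ext x y
  simp [localOp, Finset.prod_mul_distrib]

theorem trace_localOp (s : ι → Matrix (Fin 2) (Fin 2) ℂ) :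
    (localOp s).trace = ∏ i, (s i).trace := by
  simp only [Matrix.trace, Matrix.diag_apply, localOp, Matrix.of_apply]
  rw [Finset.prod_univ_sum, Fintype.piFinset_univ]

theorem sum_register {M : Type*} [AddCommMonoid M] (f : (ι ⊕ κ → Fin 2) → M) :
    ∑ u, f u = ∑ s : ι → Fin 2, ∑ t : κ → Fin 2, f (Sum.elim s t) := by
  rw [← Fintype.sum_prod_type']
  exact Fintype.sum_equiv (Equiv.sumArrowEquivProdArrow ι κ (Fin 2)) _ _
    fun u => congrArg f (Sum.elim_comp_inl_inr u).symm

theorem tensorOp_mul (A C : Op ι) (B D : Op κ) :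
    tensorOp A B * tensorOp C D = tensorOp (A * C) (B * D) := by
  ext x y
  simp only [tensorOp, Matrix.mul_apply, Matrix.of_apply, sum_register, Sum.elim_inl, Sum.elim_inr,
    Finset.sum_mul_sum]
  exact Finset.sum_congr rfl fun _ _ => Finset.sum_congr rfl fun _ _ => by ring

theorem tensorOp_one : tensorOp (1 : Op ι) (1 : Op κ) = 1 := by
  ext x y
  have h : x = y ↔ (fun i => x (Sum.inl i)) = (fun i => y (Sum.inl i)) ∧
      (fun j => x (Sum.inr j)) = fun j => y (Sum.inr j) := by
    simp only [funext_iff, Sum.forall]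
  simp only [tensorOp, Matrix.of_apply, Matrix.one_apply, h, ite_zero_mul_ite_zero, mul_one]

theorem tensorOp_localOp (s : ι → Matrix (Fin 2) (Fin 2) ℂ) (t : κ → Matrix (Fin 2) (Fin 2) ℂ) :
    tensorOp (localOp s) (localOp t) = localOp (Sum.elim s t) := by
  ext x y
  simp [tensorOp, localOp, Fintype.prod_sum_type]

/-- The operator on the register `κ` that corresponds to an operator on `ι` under a relabelling
`e` of the qubits. -/
def relabelOp (e : ι ≃ κ) : Op ι ≃⋆ₐ[ℂ] Op κ where
  toFun A := A.submatrix (fun x => x ∘ e) (fun x => x ∘ e)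
  invFun A := A.submatrix (fun x => x ∘ e.symm) (fun x => x ∘ e.symm)
  left_inv A := by ext x y; simp [Function.comp_assoc]
  right_inv A := by ext x y; simp [Function.comp_assoc]
  map_mul' A B := by
    exact (Matrix.submatrix_mul_equiv A B _ (e.symm.arrowCongr (Equiv.refl (Fin 2))) _).symm
  map_add' A B := rfl
  map_star' A := rfl
  map_smul' c A := rfl

theorem relabelOp_apply (e : ι ≃ κ) (A : Op ι) (x y : κ → Fin 2) :
    relabelOp e A x y = A (x ∘ e) (y ∘ e) := rfl

theorem relabelOp_localOp (e : ι ≃ κ) (s : ι → Matrix (Fin 2) (Fin 2) ℂ) :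
    relabelOp e (localOp s) = localOp fun j => s (e.symm j) := by
  ext x y
  simp only [relabelOp_apply, localOp, Matrix.of_apply, Function.comp]
  exact Fintype.prod_equiv e _ _ fun i => by simp

end Registers

/-! ### Pauli operators -/

section Paulis

variable {ι κ : Type} [Fintype ι] [DecidableEq ι] [Fintype κ] [DecidableEq κ]

/-- The single-qubit Pauli matrix proportional to `X ^ x * Z ^ z`, where `v = (x, z)`. -/
def bitPauli (v : ZMod 2 × ZMod 2) : Matrix (Fin 2) (Fin 2) ℂ :=
  pauliMatrix ((![![0, 3], ![1, 2]] : Fin 2 → Fin 2 → Fin 4) v.1 v.2)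

/-- The Pauli operator with label `v` in the symplectic representation: up to a phase it is
`⨂ i, X ^ (v i).1 * Z ^ (v i).2`. -/
def pauliOp (v : ι → ZMod 2 × ZMod 2) : Op ι := localOp fun i => bitPauli (v i)

/-- The symplectic form on the labels of single-qubit Pauli matrices. -/
def bitForm (u v : ZMod 2 × ZMod 2) : ZMod 2 := u.1 * v.2 + u.2 * v.1

/-- The character `a ↦ (-1) ^ a` of `ZMod 2`. -/
def bitSign (a : ZMod 2) : ℂ := if a = 0 then 1 else -1

theorem bit_cases (a : ZMod 2) : a = 0 ∨ a = 1 := by revert a; decide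

theorem bitSign_add (a b : ZMod 2) : bitSign (a + b) = bitSign a * bitSign b := by
  have h : (1 : ZMod 2) + 1 = 0 := by decide
  rcases bit_cases a with rfl | rfl <;> rcases bit_cases b with rfl | rfl <;> simp [bitSign, h]

theorem bitSign_sum (f : ι → ZMod 2) : bitSign (∑ i, f i) = ∏ i, bitSign (f i) := by
  induction (Finset.univ : Finset ι) using Finset.induction_on with
  | empty => simp [bitSign]
  | insert i s hi ih => rw [Finset.sum_insert hi, Finset.prod_insert hi, bitSign_add, ih]

theorem bitPauli_zero : bitPauli 0 = 1 := rfl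

theorem bitPauli_x : bitPauli (1, 0) = !![0, 1; 1, 0] := rfl

theorem bitPauli_z : bitPauli (0, 1) = !![1, 0; 0, -1] := rfl

theorem bitPauli_y : bitPauli (1, 1) = !![0, -Complex.I; Complex.I, 0] := rfl

theorem bitPauli_zero' : bitPauli (0, 0) = !![1, 0; 0, 1] := by
  rw [← Matrix.one_fin_two]; rfl

theorem bitPauli_mul (u v : ZMod 2 × ZMod 2) :
    ∃ c : ℂ, c ≠ 0 ∧ bitPauli u * bitPauli v = c • bitPauli (u + v) := by
  have h : (1 : ZMod 2) + 1 = 0 := by decide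
  obtain ⟨a, b⟩ := u
  obtain ⟨c, d⟩ := v
  have hI := Complex.I_ne_zero
  rcases bit_cases a with rfl | rfl <;> rcases bit_cases b with rfl | rfl <;>
    rcases bit_cases c with rfl | rfl <;> rcases bit_cases d with rfl | rfl <;>
    simp only [Prod.mk_add_mk, h, add_zero, zero_add, bitPauli_zero', bitPauli_x, bitPauli_y,
      bitPauli_z] <;>
    first
    | (refine ⟨1, one_ne_zero, ?_⟩; simp; done)
    | (refine ⟨Complex.I, hI, ?_⟩; simp; done)
    | (refine ⟨-Complex.I, neg_ne_zero.2 hI, ?_⟩; simp)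

theorem bitPauli_mul_self (u : ZMod 2 × ZMod 2) : bitPauli u * bitPauli u = 1 := by
  obtain ⟨a, b⟩ := u
  rcases bit_cases a with rfl | rfl <;> rcases bit_cases b with rfl | rfl <;>
    simp [bitPauli_zero', bitPauli_x, bitPauli_y, bitPauli_z, Matrix.one_fin_two]

theorem bitPauli_conjTranspose (u : ZMod 2 × ZMod 2) : (bitPauli u)ᴴ = bitPauli u := by
  obtain ⟨a, b⟩ := u
  ext i j
  rcases bit_cases a with rfl | rfl <;> rcases bit_cases b with rfl | rfl <;>
    fin_cases i <;> fin_cases j <;>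
    simp [bitPauli_zero', bitPauli_x, bitPauli_y, bitPauli_z]

theorem bitPauli_comm (u v : ZMod 2 × ZMod 2) :
    bitPauli u * bitPauli v = bitSign (bitForm u v) • (bitPauli v * bitPauli u) := by
  have h : (1 : ZMod 2) + 1 = 0 := by decide
  obtain ⟨a, b⟩ := u
  obtain ⟨c, d⟩ := v
  rcases bit_cases a with rfl | rfl <;> rcases bit_cases b with rfl | rfl <;>
    rcases bit_cases c with rfl | rfl <;> rcases bit_cases d with rfl | rfl <;>
    simp [bitPauli_zero', bitPauli_x, bitPauli_y, bitPauli_z, bitForm, bitSign, h]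

theorem trace_bitPauli (u : ZMod 2 × ZMod 2) : (bitPauli u).trace = if u = 0 then 2 else 0 := by
  obtain ⟨a, b⟩ := u
  rcases bit_cases a with rfl | rfl <;> rcases bit_cases b with rfl | rfl <;>
    simp [bitPauli_zero', bitPauli_x, bitPauli_y, bitPauli_z, Matrix.trace_fin_two]
  norm_num

/-- A Pauli matrix with non-zero top left entry is `I` or `Z`, hence diagonal. -/
theorem bitPauli_one_zero (u : ZMod 2 × ZMod 2) (h : bitPauli u 0 0 ≠ 0) : bitPauli u 1 0 = 0 := by
  obtain ⟨a, b⟩ := u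
  rcases bit_cases a with rfl | rfl <;> rcases bit_cases b with rfl | rfl <;>
    simp_all [bitPauli_zero', bitPauli_x, bitPauli_y, bitPauli_z]

theorem mem_paulis_iff {P : Op ι} : P ∈ paulis ι ↔ ∃ v, P = pauliOp v := by
  constructor
  · rintro ⟨p, rfl⟩
    have h : ∀ a : Fin 4, ∃ v : ZMod 2 × ZMod 2,
        (![![0, 3], ![1, 2]] : Fin 2 → Fin 2 → Fin 4) v.1 v.2 = a := by decide
    choose f hf using h
    exact ⟨fun i => f (p i), by simp only [pauliOp, bitPauli, hf]⟩
  · rintro ⟨v, rfl⟩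
    exact ⟨_, rfl⟩

theorem pauliOp_mem (v : ι → ZMod 2 × ZMod 2) : pauliOp v ∈ paulis ι := mem_paulis_iff.2 ⟨v, rfl⟩

theorem pauliOp_zero : pauliOp (0 : ι → ZMod 2 × ZMod 2) = 1 := localOp_one

theorem pauliOp_mul (u v : ι → ZMod 2 × ZMod 2) :
    ∃ c : ℂ, c ≠ 0 ∧ pauliOp u * pauliOp v = c • pauliOp (u + v) := by
  choose c hc h using fun i => bitPauli_mul (u i) (v i)
  refine ⟨∏ i, c i, Finset.prod_ne_zero_iff.2 fun i _ => hc i, ?_⟩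
  simp only [pauliOp, localOp_mul, h, Pi.add_apply]
  exact localOp_smul _ _

theorem pauliOp_mul_self (u : ι → ZMod 2 × ZMod 2) : pauliOp u * pauliOp u = 1 := by
  simp only [pauliOp, localOp_mul, bitPauli_mul_self, localOp_one]

theorem pauliOp_conjTranspose (u : ι → ZMod 2 × ZMod 2) : (pauliOp u)ᴴ = pauliOp u := by
  simp only [pauliOp, localOp_conjTranspose, bitPauli_conjTranspose]

theorem pauliOp_comm (u v : ι → ZMod 2 × ZMod 2) :
    pauliOp u * pauliOp v = bitSign (∑ i, bitForm (u i) (v i)) • (pauliOp v * pauliOp u) := by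
  simp only [pauliOp, localOp_mul, bitSign_sum]
  rw [← localOp_smul]
  exact congrArg localOp (funext fun i => bitPauli_comm _ _)

theorem pauliOp_ne_zero (u : ι → ZMod 2 × ZMod 2) : pauliOp u ≠ 0 := fun h => by
  have := pauliOp_mul_self u
  rw [h, zero_mul] at this
  exact zero_ne_one this

theorem trace_pauliOp (u : ι → ZMod 2 × ZMod 2) :
    (pauliOp u).trace = if u = 0 then 2 ^ Fintype.card ι else 0 := by
  rw [pauliOp, trace_localOp]
  split_ifs with h
  · subst h; simp [trace_bitPauli]
  · obtain ⟨i, hi⟩ := Function.ne_iff.1 h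
    exact Finset.prod_eq_zero (Finset.mem_univ i) (by rw [trace_bitPauli]; exact if_neg hi)

theorem label_add_eq_zero {u v : ι → ZMod 2 × ZMod 2} : u + v = 0 ↔ u = v := by
  have h : v + v = 0 := by
    ext i
    exacts [CharTwo.add_self_eq_zero _, CharTwo.add_self_eq_zero _]
  rw [add_eq_zero_iff_eq_neg, ← eq_neg_of_add_eq_zero_left h]

theorem trace_pauliOp_mul_self (u : ι → ZMod 2 × ZMod 2) :
    (pauliOp u * pauliOp u).trace = 2 ^ Fintype.card ι := by
  simp [pauliOp_mul_self, Matrix.trace_one]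

theorem trace_pauliOp_mul {u v : ι → ZMod 2 × ZMod 2} (h : u ≠ v) :
    (pauliOp u * pauliOp v).trace = 0 := by
  obtain ⟨c, -, hc⟩ := pauliOp_mul u v
  rw [hc, Matrix.trace_smul, trace_pauliOp, if_neg (mt label_add_eq_zero.1 h), smul_zero]

/-- The Pauli operators form a basis, being `4 ^ n` operators that are orthogonal for the trace
form. -/
theorem pauliOp_expansion (A : Op ι) :
    A = ∑ v, ((2 : ℂ) ^ Fintype.card ι)⁻¹ • (A * pauliOp v).trace • pauliOp v := by
  have h2 : (2 : ℂ) ^ Fintype.card ι ≠ 0 := pow_ne_zero _ two_ne_zero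
  have hli : LinearIndependent ℂ (pauliOp (ι := ι)) := by
    rw [Fintype.linearIndependent_iff]
    intro g hg v
    have := congrArg (fun M => (M * pauliOp v).trace) hg
    simp only [Finset.sum_mul, Matrix.trace_sum, Matrix.smul_mul, Matrix.trace_smul, zero_mul,
      Matrix.trace_zero] at this
    rw [Finset.sum_eq_single v (fun w _ hw => by rw [trace_pauliOp_mul hw, smul_zero])
      (fun h => absurd (Finset.mem_univ v) h), trace_pauliOp_mul_self, smul_eq_mul] at this
    exact (mul_eq_zero.1 this).resolve_right h2
  have hspan : Submodule.span ℂ (Set.range (pauliOp (ι := ι))) = ⊤ := by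
    apply hli.span_eq_top_of_card_eq_finrank'
    rw [Module.finrank_matrix]
    simp [← mul_pow]
  have hA : A ∈ Submodule.span ℂ (Set.range (pauliOp (ι := ι))) := hspan ▸ Submodule.mem_top
  obtain ⟨g, hg⟩ := (Submodule.mem_span_range_iff_exists_fun ℂ).1 hA
  conv_lhs => rw [← hg]
  refine Finset.sum_congr rfl fun v _ => ?_
  rw [← hg, Finset.sum_mul, Matrix.trace_sum, Finset.sum_eq_single v, Matrix.smul_mul,
    Matrix.trace_smul, trace_pauliOp_mul_self, smul_eq_mul, smul_smul]
  · congr 1; field_simp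
  · intro w _ hw
    rw [Matrix.smul_mul, Matrix.trace_smul, trace_pauliOp_mul hw, smul_zero]
  · exact fun h => absurd (Finset.mem_univ v) h

theorem tensorOp_pauliOp (u : ι → ZMod 2 × ZMod 2) (v : κ → ZMod 2 × ZMod 2) :
    tensorOp (pauliOp u) (pauliOp v) = pauliOp (Sum.elim u v) := by
  rw [pauliOp, pauliOp, tensorOp_localOp, pauliOp]
  exact congrArg localOp (funext fun i => by cases i <;> rfl)

theorem pauliOp_sum (w : ι ⊕ κ → ZMod 2 × ZMod 2) :
    pauliOp w = tensorOp (pauliOp (w ∘ Sum.inl)) (pauliOp (w ∘ Sum.inr)) := by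
  rw [tensorOp_pauliOp, Sum.elim_comp_inl_inr]

theorem relabelOp_pauliOp (e : ι ≃ κ) (v : ι → ZMod 2 × ZMod 2) :
    relabelOp e (pauliOp v) = pauliOp (v ∘ e.symm) := relabelOp_localOp e _

theorem pauliOp_commute_or (u v : ι → ZMod 2 × ZMod 2) :
    pauliOp u * pauliOp v = pauliOp v * pauliOp u ∨
      pauliOp u * pauliOp v = -(pauliOp v * pauliOp u) := by
  rw [pauliOp_comm u v]
  rcases bit_cases (∑ i, bitForm (u i) (v i)) with h | h <;> simp [h, bitSign]

end Paulis

/-! ### Supermaps as conjugations of Kraus operators -/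

section Supermaps

variable {ι κ μ : Type} [Fintype ι] [DecidableEq ι] [Fintype κ] [DecidableEq κ]
  [Fintype μ] [DecidableEq μ]

/-- The map `ρ ↦ A ρ B`. -/
def sandwich (A B : Op ι) : Superop ι := LinearMap.mulLeft ℂ A ∘ₗ LinearMap.mulRight ℂ B

theorem sandwich_apply (A B ρ : Op ι) : sandwich A B ρ = A * ρ * B := by
  simp [sandwich, mul_assoc]

theorem unitaryChannel_apply (A ρ : Op ι) : unitaryChannel A ρ = A * ρ * Aᴴ := rfl

theorem unitaryChannel_eq_sandwich (A : Op ι) : unitaryChannel A = sandwich A Aᴴ :=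
  LinearMap.ext fun ρ => (sandwich_apply A Aᴴ ρ).symm

/-- Every superoperator is a combination of maps `ρ ↦ A ρ B`: for matrix units,
`E_{as} ρ E_{tb} = ρ_{st} E_{ab}`. -/
theorem span_sandwich :
    Submodule.span ℂ (Set.range fun p : Op ι × Op ι => sandwich p.1 p.2) = ⊤ := by
  refine eq_top_iff.2 fun Φ _ => ?_
  have h : Φ = ∑ s, ∑ t, ∑ a, ∑ b, (Φ (single s t 1)) a b • sandwich (single a s 1)
      (single t b 1) := by
    refine LinearMap.ext fun ρ => ?_
    simp only [LinearMap.sum_apply, LinearMap.smul_apply, sandwich_apply,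
      Matrix.single_mul_mul_single]
    conv_lhs => rw [Matrix.matrix_eq_sum_single ρ]
    simp only [map_sum]
    refine Finset.sum_congr rfl fun s _ => Finset.sum_congr rfl fun t _ => ?_
    have h1 : single s t (ρ s t) = ρ s t • single s t (1 : ℂ) := by simp
    rw [h1, map_smul]
    conv_lhs => rw [Matrix.matrix_eq_sum_single (Φ (single s t 1))]
    simp only [Finset.smul_sum]
    refine Finset.sum_congr rfl fun a _ => Finset.sum_congr rfl fun b _ => ?_
    simp [mul_comm]
  rw [h]
  exact Submodule.sum_mem _ fun s _ => Submodule.sum_mem _ fun t _ => Submodule.sum_mem _ fun a _ =>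
    Submodule.sum_mem _ fun b _ => Submodule.smul_mem _ _ (Submodule.subset_span ⟨(_, _), rfl⟩)

variable (ι κ) in
/-- The isometry `|x⟩ ↦ |x⟩ ⊗ |0⋯0⟩` that attaches the ancilla register `κ`. -/
def ancillaIsometry : Matrix (ι ⊕ κ → Fin 2) (ι → Fin 2) ℂ :=
  Matrix.of fun u x => if (fun j => u (Sum.inr j)) = 0 then
    (1 : Op ι) (fun i => u (Sum.inl i)) x else 0

theorem ancillaIsometry_mul_apply {l : Type*} (A : Matrix (ι → Fin 2) l ℂ) (u : ι ⊕ κ → Fin 2)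
    (y : l) : (ancillaIsometry ι κ * A) u y =
      if (fun j => u (Sum.inr j)) = 0 then A (fun i => u (Sum.inl i)) y else 0 := by
  simp [Matrix.mul_apply, ancillaIsometry, Matrix.one_apply]

theorem mul_ancillaIsometry_apply {l : Type*} (M : Matrix l (ι ⊕ κ → Fin 2) ℂ) (u : l)
    (x : ι → Fin 2) : (M * ancillaIsometry ι κ) u x = M u (Sum.elim x 0) := by
  simp only [Matrix.mul_apply, ancillaIsometry, Matrix.one_apply, sum_register, Matrix.of_apply,
    Sum.elim_inl, Sum.elim_inr]
  rw [Finset.sum_eq_single x]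
  · simp
  · intro y _ hy
    simp [hy]
  · simp

theorem conjTranspose_ancillaIsometry_mul_apply {l : Type*} (M : Matrix (ι ⊕ κ → Fin 2) l ℂ)
    (x : ι → Fin 2) (u : l) : ((ancillaIsometry ι κ)ᴴ * M) x u = M (Sum.elim x 0) u := by
  have h := mul_ancillaIsometry_apply Mᴴ u x
  rw [← star_inj, ← Matrix.conjTranspose_apply, Matrix.conjTranspose_mul,
    Matrix.conjTranspose_conjTranspose, h, Matrix.conjTranspose_apply]

theorem postselectAncilla_eq (M : Op (ι ⊕ κ)) :
    postselectAncilla ι κ M = (ancillaIsometry ι κ)ᴴ * M * ancillaIsometry ι κ := by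
  ext x y
  rw [mul_ancillaIsometry_apply, conjTranspose_ancillaIsometry_mul_apply]
  rfl

theorem ancillaIsometry_isometry :
    (ancillaIsometry ι κ)ᴴ * ancillaIsometry ι κ = 1 := by
  ext x y
  rw [conjTranspose_ancillaIsometry_mul_apply]
  exact if_pos rfl

theorem localOp_zeroProjection (x y : κ → Fin 2) :
    localOp (fun _ => !![1, 0; 0, 0]) x y = if x = 0 ∧ y = 0 then 1 else 0 := by
  have h : ∀ a b : Fin 2, (!![1, 0; 0, 0] : Matrix (Fin 2) (Fin 2) ℂ) a b =
      if a = 0 ∧ b = 0 then 1 else 0 := by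
    intro a b; fin_cases a <;> fin_cases b <;> simp
  simp only [localOp, Matrix.of_apply, h, Finset.prod_boole, Finset.mem_univ, true_imp_iff,
    funext_iff, forall_and, Pi.zero_apply]

theorem attachAncilla_eq (ρ : Op ι) :
    attachAncilla ι κ ρ = ancillaIsometry ι κ * ρ * (ancillaIsometry ι κ)ᴴ := by
  ext u v
  rw [← star_star ((ancillaIsometry ι κ * ρ * (ancillaIsometry ι κ)ᴴ) u v),
    ← Matrix.conjTranspose_apply, Matrix.conjTranspose_mul, Matrix.conjTranspose_conjTranspose,
    ancillaIsometry_mul_apply, Matrix.conjTranspose_apply, ancillaIsometry_mul_apply]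
  change ρ _ _ * localOp _ _ _ = _
  rw [localOp_zeroProjection]
  by_cases h1 : (fun j => u (Sum.inr j)) = 0 <;> by_cases h2 : (fun j => v (Sum.inr j)) = 0 <;>
    simp [h1, h2]

theorem tensorOp_one_mul_apply (A : Op ι) (M : Op (ι ⊕ κ)) (x y : ι ⊕ κ → Fin 2) :
    (tensorOp A 1 * M : Op (ι ⊕ κ)) x y =
      ∑ s, A (fun i => x (Sum.inl i)) s * M (Sum.elim s fun j => x (Sum.inr j)) y := by
  have h : ∀ (s : ι → Fin 2) (t : κ → Fin 2), tensorOp A (1 : Op κ) x (Sum.elim s t) =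
      A (fun i => x (Sum.inl i)) s * (1 : Op κ) (fun j => x (Sum.inr j)) t := fun _ _ => rfl
  simp only [Matrix.mul_apply, sum_register, h, Matrix.one_apply, mul_ite, ite_mul, mul_one,
    mul_zero, zero_mul, Finset.sum_ite_eq, Finset.mem_univ, if_true]

theorem mul_tensorOp_one_apply (B : Op ι) (M : Op (ι ⊕ κ)) (x y : ι ⊕ κ → Fin 2) :
    (M * tensorOp B 1 : Op (ι ⊕ κ)) x y =
      ∑ t, M x (Sum.elim t fun j => y (Sum.inr j)) * B t (fun i => y (Sum.inl i)) := by
  have h : ∀ (s : ι → Fin 2) (t : κ → Fin 2), tensorOp B (1 : Op κ) (Sum.elim s t) y =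
      B s (fun i => y (Sum.inl i)) * (1 : Op κ) t (fun j => y (Sum.inr j)) := fun _ _ => rfl
  simp only [Matrix.mul_apply, sum_register, h, Matrix.one_apply, mul_ite, mul_one,
    mul_zero, Finset.sum_ite_eq', Finset.mem_univ, if_true]

theorem tensorId_sandwich (A B : Op ι) :
    tensorId κ (sandwich A B) = sandwich (tensorOp A 1) (tensorOp B 1) := by
  refine LinearMap.ext fun M => ?_
  ext x y
  rw [sandwich_apply, mul_tensorOp_one_apply]
  simp only [tensorOp_one_mul_apply]
  change (sandwich A B _) _ _ = _
  rw [sandwich_apply, Matrix.mul_apply]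
  simp only [Matrix.mul_apply, Matrix.of_apply]

theorem tensorOp_one_mul_ancillaIsometry (A : Op ι) :
    tensorOp A (1 : Op κ) * ancillaIsometry ι κ = ancillaIsometry ι κ * A := by
  ext u x
  rw [mul_ancillaIsometry_apply, ancillaIsometry_mul_apply]
  simp only [tensorOp, Matrix.of_apply, Matrix.one_apply, Sum.elim_inl, Sum.elim_inr, mul_ite,
    mul_one, mul_zero]
  rfl

/-- The action of a supermap on Kraus operators: `A ↦ ⟨0⋯0| U_D (A ⊗ 1) U_E |0⋯0⟩`. -/
def compression (UE UD : Op (ι ⊕ κ)) (A : Op ι) : Op ι :=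
  postselectAncilla ι κ (UD * tensorOp A 1 * UE)

theorem detectionSupermap_sandwich (UE UD : Op (ι ⊕ κ)) (A B : Op ι) :
    detectionSupermap UE UD (sandwich A B) =
      sandwich (compression UE UD A) (compression UE UD Bᴴ)ᴴ := by
  refine LinearMap.ext fun ρ => ?_
  simp only [detectionSupermap, tensorId_sandwich, LinearMap.comp_apply, unitaryChannel_apply,
    sandwich_apply, attachAncilla_eq, postselectAncilla_eq, compression, Matrix.conjTranspose_mul,
    Matrix.conjTranspose_conjTranspose, tensorOp_conjTranspose, Matrix.conjTranspose_one]
  simp only [Matrix.mul_assoc]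

theorem detectionSupermap_unitaryChannel (UE UD : Op (ι ⊕ κ)) (A : Op ι) :
    detectionSupermap UE UD (unitaryChannel A) = unitaryChannel (compression UE UD A) := by
  rw [unitaryChannel_eq_sandwich, detectionSupermap_sandwich, Matrix.conjTranspose_conjTranspose,
    unitaryChannel_eq_sandwich]

/-- An error-detection supermap is linear in the channel it acts on. -/
def detectionLinear (UE UD : Op (ι ⊕ κ)) : Superop ι →ₗ[ℂ] Superop ι where
  toFun := detectionSupermap UE UD
  map_add' Φ Ψ := by
    have h : tensorId κ (Φ + Ψ) = tensorId κ Φ + tensorId κ Ψ := rfl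
    simp only [detectionSupermap, h, LinearMap.add_comp, LinearMap.comp_add]
  map_smul' c Φ := by
    have h : tensorId κ (c • Φ) = c • tensorId κ Φ := rfl
    simp only [detectionSupermap, h, LinearMap.smul_comp, LinearMap.comp_smul, RingHom.id_apply]

/-- A linear supermap is determined by its action on the maps `ρ ↦ A ρ B`. -/
theorem supermap_ext {F G : Superop ι →ₗ[ℂ] Superop ι}
    (h : ∀ A B, F (sandwich A B) = G (sandwich A B)) : F = G :=
  LinearMap.ext_on_range span_sandwich fun p => h p.1 p.2

theorem compression_one : compression (1 : Op (ι ⊕ κ)) 1 = (id : Op ι → Op ι) := by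
  funext A
  rw [compression, one_mul, mul_one, postselectAncilla_eq, Matrix.mul_assoc,
    tensorOp_one_mul_ancillaIsometry, ← Matrix.mul_assoc, ancillaIsometry_isometry, one_mul, id]

theorem detectionSupermap_one : detectionSupermap (1 : Op (ι ⊕ κ)) 1 = id := by
  have h : detectionLinear (1 : Op (ι ⊕ κ)) 1 = LinearMap.id := supermap_ext fun A B => by
    change detectionSupermap _ _ _ = sandwich A B
    rw [detectionSupermap_sandwich, compression_one, id, id, Matrix.conjTranspose_conjTranspose]
  exact congrArg DFunLike.coe h

theorem detectionSupermap_comp {ν : Type} [Fintype ν] [DecidableEq ν] {UE UD : Op (ι ⊕ κ)}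
    {VE VD : Op (ι ⊕ μ)} {WE WD : Op (ι ⊕ ν)}
    (h : compression UE UD ∘ compression VE VD = compression WE WD) :
    detectionSupermap UE UD ∘ detectionSupermap VE VD = detectionSupermap WE WD := by
  have h' : detectionLinear UE UD ∘ₗ detectionLinear VE VD = detectionLinear WE WD :=
    supermap_ext fun A B => by
      change detectionSupermap _ _ (detectionSupermap _ _ _) = detectionSupermap _ _ _
      rw [detectionSupermap_sandwich, detectionSupermap_sandwich, detectionSupermap_sandwich,
        Matrix.conjTranspose_conjTranspose, ← h]
      rfl
  exact congrArg DFunLike.coe h'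

/-- Extends an operator on `ι ⊕ κ` trivially to the register `μ`, where `κ` and `μ` are the two
halves of a joint ancilla register. -/
def extendLeft (μ : Type) [Fintype μ] [DecidableEq μ] (U : Op (ι ⊕ κ)) : Op (ι ⊕ (κ ⊕ μ)) :=
  relabelOp (Equiv.sumAssoc ι κ μ) (tensorOp U 1)

/-- Extends an operator on `ι ⊕ μ` trivially to the register `κ`, where `κ` and `μ` are the two
halves of a joint ancilla register. -/
def extendRight (κ : Type) [Fintype κ] [DecidableEq κ] (U : Op (ι ⊕ μ)) : Op (ι ⊕ (κ ⊕ μ)) :=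
  relabelOp (((Equiv.sumAssoc ι μ κ).trans ((Equiv.refl ι).sumCongr (Equiv.sumComm μ κ))))
    (tensorOp U 1)

/-- Composition of supermaps: the outer encoder acts before the inner one, on its own ancillas. -/
theorem compression_comp (UE UD : Op (ι ⊕ μ)) (VE VD : Op (ι ⊕ κ)) :
    compression UE UD ∘ compression VE VD =
      compression (extendLeft μ VE * extendRight κ UE) (extendRight κ UD * extendLeft μ VD) := by
  funext A
  set e : (ι ⊕ μ) ⊕ κ ≃ ι ⊕ (κ ⊕ μ) :=
    (Equiv.sumAssoc ι μ κ).trans ((Equiv.refl ι).sumCongr (Equiv.sumComm μ κ)) with he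
  set N := extendLeft μ (VD * tensorOp A 1 * VE) with hN
  have hA : tensorOp A (1 : Op (κ ⊕ μ)) = extendLeft μ (tensorOp A (1 : Op κ)) := by
    ext x y
    simp only [extendLeft, relabelOp_apply, tensorOp, Matrix.of_apply, mul_assoc]
    congr 1
    have h := congrFun₂ (tensorOp_one (ι := κ) (κ := μ)) (fun j => x (Sum.inr j))
      fun j => y (Sum.inr j)
    exact h.symm
  have hmul : extendRight κ UD * extendLeft μ VD * tensorOp A 1 *
      (extendLeft μ VE * extendRight κ UE) = extendRight κ UD * N * extendRight κ UE := by
    have hN' : N = extendLeft μ VD * extendLeft μ (tensorOp A 1) * extendLeft μ VE := by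
      simp only [hN, extendLeft, ← map_mul, tensorOp_mul, mul_one]
    rw [hA, hN']
    simp only [Matrix.mul_assoc]
  -- Post-selection of the joint ancilla register can be done one half after the other.
  have hpost : ∀ M : Op (ι ⊕ (κ ⊕ μ)), postselectAncilla ι (κ ⊕ μ) M =
      postselectAncilla ι μ (postselectAncilla (ι ⊕ μ) κ (relabelOp e.symm M)) := by
    intro M
    ext x y
    simp only [postselectAncilla, LinearMap.coe_mk, AddHom.coe_mk, Matrix.of_apply,
      relabelOp_apply]
    congr 1 <;> funext i <;> rcases i with i | i | i <;> rfl
  have hRight : ∀ U : Op (ι ⊕ μ), relabelOp e.symm (extendRight κ U) = tensorOp U 1 := by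
    intro U
    ext x y
    simp [extendRight, ← he, relabelOp_apply, Function.comp_assoc]
  have hNpost : postselectAncilla (ι ⊕ μ) κ (relabelOp e.symm N) =
      tensorOp (compression VE VD A) 1 := by
    ext x y
    simp only [postselectAncilla, LinearMap.coe_mk, AddHom.coe_mk, Matrix.of_apply, relabelOp_apply,
      hN, extendLeft, tensorOp, compression]
    refine congrArg₂ (· * ·) (congrArg₂ (VD * tensorOp A 1 * VE) ?_ ?_) rfl <;> funext i <;>
      rcases i with i | i <;> rfl
  change compression UE UD (compression VE VD A) = postselectAncilla ι (κ ⊕ μ) _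
  rw [hmul, hpost, map_mul (relabelOp e.symm), map_mul (relabelOp e.symm), hRight, hRight,
    compression]
  congr 1
  rw [postselectAncilla_eq, ← hNpost, postselectAncilla_eq]
  have h := congrArg Matrix.conjTranspose (tensorOp_one_mul_ancillaIsometry (κ := κ) UDᴴ)
  rw [Matrix.conjTranspose_mul, Matrix.conjTranspose_mul, tensorOp_conjTranspose,
    Matrix.conjTranspose_conjTranspose, Matrix.conjTranspose_one] at h
  calc _ = (UD * (ancillaIsometry (ι ⊕ μ) κ)ᴴ) * relabelOp e.symm N *
        (ancillaIsometry (ι ⊕ μ) κ * UE) := by simp only [Matrix.mul_assoc]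
    _ = _ := by rw [← h, ← tensorOp_one_mul_ancillaIsometry]; simp only [Matrix.mul_assoc]

/-- Relabelling the ancilla qubits does not change the supermap. -/
theorem compression_relabel (e : κ ≃ μ) (UE UD : Op (ι ⊕ κ)) :
    compression (relabelOp ((Equiv.refl ι).sumCongr e) UE)
      (relabelOp ((Equiv.refl ι).sumCongr e) UD) = compression UE UD := by
  funext A
  have hA : tensorOp A (1 : Op μ) =
      relabelOp ((Equiv.refl ι).sumCongr e) (tensorOp A (1 : Op κ)) := by
    ext x y
    simp only [relabelOp_apply, tensorOp, Matrix.of_apply]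
    congr 1
    have h := congrFun₂ (map_one (relabelOp e)) (fun j => x (Sum.inr j)) fun j => y (Sum.inr j)
    exact h.symm
  rw [compression, compression, hA, ← map_mul, ← map_mul]
  ext x y
  simp only [postselectAncilla, LinearMap.coe_mk, AddHom.coe_mk, Matrix.of_apply, relabelOp_apply]
  refine congrArg₂ (UD * tensorOp A 1 * UE) ?_ ?_ <;> funext i <;> rcases i with i | i <;> rfl

end Supermaps

/-! ### Clifford unitaries -/

section Clifford

variable {ι κ μ : Type} [Fintype ι] [DecidableEq ι] [Fintype κ] [DecidableEq κ]
  [Fintype μ] [DecidableEq μ]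

/-- `M` is a scalar multiple of a Pauli operator. -/
def IsPauliMultiple (M : Op ι) : Prop := ∃ (c : ℂ) (v : ι → ZMod 2 × ZMod 2), M = c • pauliOp v

theorem isPauliMultiple_pauliOp (v : ι → ZMod 2 × ZMod 2) : IsPauliMultiple (pauliOp v) :=
  ⟨1, v, (one_smul _ _).symm⟩

theorem IsPauliMultiple.mul {M N : Op ι} (hM : IsPauliMultiple M) (hN : IsPauliMultiple N) :
    IsPauliMultiple (M * N) := by
  obtain ⟨c, u, rfl⟩ := hM
  obtain ⟨d, v, rfl⟩ := hN
  obtain ⟨k, -, h⟩ := pauliOp_mul u v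
  exact ⟨c * d * k, u + v, by rw [smul_mul_smul_comm, h, smul_smul]⟩

theorem IsPauliMultiple.smul {M : Op ι} (hM : IsPauliMultiple M) (c : ℂ) :
    IsPauliMultiple (c • M) := by
  obtain ⟨d, u, rfl⟩ := hM
  exact ⟨c * d, u, by rw [smul_smul]⟩

theorem IsPauliMultiple.neg {M : Op ι} (hM : IsPauliMultiple M) : IsPauliMultiple (-M) := by
  simpa using hM.smul (-1)

/-- A unitary is Clifford as soon as it conjugates Pauli operators to multiples of Pauli operators:
the conjugated operator is an involution, so the scalar is a sign. -/
theorem isClifford_of_isPauliMultiple {U : Op ι} (hU : U ∈ Matrix.unitaryGroup (ι → Fin 2) ℂ)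
    (h : ∀ v, IsPauliMultiple (U * pauliOp v * Uᴴ)) : IsClifford U := by
  refine ⟨hU, fun P hP => ?_⟩
  obtain ⟨v, rfl⟩ := mem_paulis_iff.1 hP
  obtain ⟨c, w, hc⟩ := h v
  have h1 : Uᴴ * U = 1 := Matrix.mem_unitaryGroup_iff'.1 hU
  have h2 : U * Uᴴ = 1 := Matrix.mem_unitaryGroup_iff.1 hU
  have hsq : (U * pauliOp v * Uᴴ) * (U * pauliOp v * Uᴴ) = 1 := by
    calc _ = U * (pauliOp v * (Uᴴ * U) * pauliOp v) * Uᴴ := by simp only [Matrix.mul_assoc]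
      _ = 1 := by rw [h1, Matrix.mul_one, pauliOp_mul_self, Matrix.mul_one, h2]
  rw [hc, smul_mul_smul_comm, pauliOp_mul_self] at hsq
  have hcc : c * c = 1 := by
    have := congrFun (congrFun hsq 0) 0
    simpa using this
  rw [hc]
  rcases mul_self_eq_one_iff.1 hcc with rfl | rfl
  · exact Or.inl (by rw [one_smul]; exact pauliOp_mem w)
  · exact Or.inr (by rw [neg_smul, one_smul, neg_neg]; exact pauliOp_mem w)

theorem IsClifford.isPauliMultiple {U : Op ι} (hU : IsClifford U) (v : ι → ZMod 2 × ZMod 2) :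
    IsPauliMultiple (U * pauliOp v * Uᴴ) := by
  rcases hU.2 _ (pauliOp_mem v) with h | h
  · obtain ⟨w, hw⟩ := mem_paulis_iff.1 h
    exact hw ▸ isPauliMultiple_pauliOp w
  · obtain ⟨w, hw⟩ := mem_paulis_iff.1 h
    rw [← neg_neg (U * pauliOp v * Uᴴ), hw]
    exact (isPauliMultiple_pauliOp w).neg

theorem IsClifford.one : IsClifford (1 : Op ι) :=
  isClifford_of_isPauliMultiple (one_mem _) fun v => by
    simpa using isPauliMultiple_pauliOp v

theorem IsClifford.mul {U V : Op ι} (hU : IsClifford U) (hV : IsClifford V) :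
    IsClifford (U * V) := by
  refine isClifford_of_isPauliMultiple (mul_mem hU.1 hV.1) fun v => ?_
  obtain ⟨c, w, hc⟩ := hV.isPauliMultiple v
  have h : U * V * pauliOp v * (U * V)ᴴ = c • (U * pauliOp w * Uᴴ) := by
    calc _ = U * (V * pauliOp v * Vᴴ) * Uᴴ := by
          rw [Matrix.conjTranspose_mul]; simp only [Matrix.mul_assoc]
      _ = _ := by rw [hc, Matrix.mul_smul, Matrix.smul_mul]
  exact h ▸ (hU.isPauliMultiple w).smul c

theorem IsClifford.tensorOp_one {U : Op ι} (hU : IsClifford U) :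
    IsClifford (tensorOp U (1 : Op κ)) := by
  refine isClifford_of_isPauliMultiple ?_ fun v => ?_
  · rw [Matrix.mem_unitaryGroup_iff, Matrix.star_eq_conjTranspose, tensorOp_conjTranspose,
      tensorOp_mul, Matrix.conjTranspose_one, mul_one, ← Matrix.star_eq_conjTranspose,
      Matrix.mem_unitaryGroup_iff.1 hU.1, SCV.tensorOp_one]
  · obtain ⟨c, w, hc⟩ := hU.isPauliMultiple (v ∘ Sum.inl)
    refine ⟨c, Sum.elim w (v ∘ Sum.inr), ?_⟩
    rw [pauliOp_sum, tensorOp_conjTranspose, tensorOp_mul, tensorOp_mul, hc, tensorOp_smul_left,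
      Matrix.conjTranspose_one, mul_one, one_mul, tensorOp_pauliOp]

theorem IsClifford.relabelOp {U : Op ι} (hU : IsClifford U) (e : ι ≃ κ) :
    IsClifford (relabelOp e U) := by
  refine isClifford_of_isPauliMultiple ?_ fun v => ?_
  · rw [Matrix.mem_unitaryGroup_iff, ← map_star, ← map_mul, Matrix.mem_unitaryGroup_iff.1 hU.1,
      map_one]
  · obtain ⟨c, w, hc⟩ := hU.isPauliMultiple (v ∘ e)
    refine ⟨c, w ∘ e.symm, ?_⟩
    have hv : pauliOp v = SCV.relabelOp e (pauliOp (v ∘ e)) := by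
      rw [relabelOp_pauliOp, Function.comp_assoc, Equiv.self_comp_symm, Function.comp_id]
    rw [hv, ← Matrix.star_eq_conjTranspose, ← map_star, ← map_mul, ← map_mul,
      Matrix.star_eq_conjTranspose, hc, map_smul, relabelOp_pauliOp]

theorem isClifford_of_involution {U : Op ι} (hU : Uᴴ = U) (hsq : U * U = 1)
    (h : ∀ v, IsPauliMultiple (U * pauliOp v * U)) : IsClifford U :=
  isClifford_of_isPauliMultiple
    (by rw [Matrix.mem_unitaryGroup_iff, Matrix.star_eq_conjTranspose, hU, hsq])
    fun v => by rw [hU]; exact h v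

theorem inv_sqrt_two_mul_self : ((Real.sqrt 2 : ℂ))⁻¹ * ((Real.sqrt 2 : ℂ))⁻¹ = 1 / 2 := by
  rw [← mul_inv, ← Complex.ofReal_mul, Real.mul_self_sqrt zero_le_two]; norm_num

/-- The Hadamard-type gate `(A + B) / √2` of two anticommuting Pauli operators. -/
theorem isClifford_of_anticommute {a b : ι → ZMod 2 × ZMod 2}
    (hab : pauliOp b * pauliOp a = -(pauliOp a * pauliOp b)) :
    IsClifford (((Real.sqrt 2 : ℂ))⁻¹ • (pauliOp a + pauliOp b)) := by
  have hA := pauliOp_mul_self a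
  have hB := pauliOp_mul_self b
  have ha := isPauliMultiple_pauliOp a
  have hb := isPauliMultiple_pauliOp b
  have hA' : ∀ M, pauliOp a * (pauliOp a * M) = M := fun M => by rw [← mul_assoc, hA, one_mul]
  have hB' : ∀ M, pauliOp b * (pauliOp b * M) = M := fun M => by rw [← mul_assoc, hB, one_mul]
  have hab' : ∀ M, pauliOp b * (pauliOp a * M) = -(pauliOp a * (pauliOp b * M)) := fun M => by
    rw [← mul_assoc, hab, neg_mul, mul_assoc]
  refine isClifford_of_involution ?_ ?_ fun v => ?_
  · rw [Matrix.conjTranspose_smul, Matrix.conjTranspose_add, pauliOp_conjTranspose,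
      pauliOp_conjTranspose]
    simp
  · rw [smul_mul_smul_comm, inv_sqrt_two_mul_self]
    simp only [mul_add, add_mul, hA, hB, hab]
    module
  · have hv := isPauliMultiple_pauliOp v
    rw [smul_mul_assoc, smul_mul_smul_comm, inv_sqrt_two_mul_self]
    -- The image of a Pauli operator depends only on whether it commutes with `A` and with `B`.
    rcases pauliOp_commute_or v a with h1 | h1 <;> rcases pauliOp_commute_or v b with h2 | h2
    · convert hv using 1
      simp only [mul_add, add_mul, mul_assoc, h1, h2, hA', hB', hab']
      module
    · convert ((ha.mul hb).mul hv).neg using 1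
      simp only [mul_add, add_mul, mul_assoc, h1, h2, hA', hB', hab', mul_neg]
      module
    · convert ((ha.mul hb).mul hv) using 1
      simp only [mul_add, add_mul, mul_assoc, h1, h2, hA', hB', hab', mul_neg]
      module
    · convert hv.neg using 1
      simp only [mul_add, add_mul, mul_assoc, h1, h2, hA', hB', hab', mul_neg]
      module

/-- The controlled gate `(1 + A + B - A B) / 2` of two commuting Pauli operators: it is `B` on the
`-1`-eigenspace of `A`, and the identity on the `+1`-eigenspace. -/
theorem isClifford_of_commute {a b : ι → ZMod 2 × ZMod 2}
    (hab : pauliOp b * pauliOp a = pauliOp a * pauliOp b) :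
    IsClifford ((1 / 2 : ℂ) • (1 + pauliOp a + pauliOp b - pauliOp a * pauliOp b)) := by
  have hA := pauliOp_mul_self a
  have hB := pauliOp_mul_self b
  have ha := isPauliMultiple_pauliOp a
  have hb := isPauliMultiple_pauliOp b
  have hA' : ∀ M, pauliOp a * (pauliOp a * M) = M := fun M => by rw [← mul_assoc, hA, one_mul]
  have hB' : ∀ M, pauliOp b * (pauliOp b * M) = M := fun M => by rw [← mul_assoc, hB, one_mul]
  have hab' : ∀ M, pauliOp b * (pauliOp a * M) = pauliOp a * (pauliOp b * M) := fun M => by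
    rw [← mul_assoc, hab, mul_assoc]
  refine isClifford_of_involution ?_ ?_ fun v => ?_
  · rw [Matrix.conjTranspose_smul, Matrix.conjTranspose_sub, Matrix.conjTranspose_add,
      Matrix.conjTranspose_add, Matrix.conjTranspose_mul, pauliOp_conjTranspose,
      pauliOp_conjTranspose, Matrix.conjTranspose_one, hab]
    simp
  · rw [smul_mul_smul_comm]
    simp only [mul_add, add_mul, mul_sub, sub_mul, one_mul, mul_one, mul_assoc, hA, hB, hab, hA',
      hab']
    module
  · have hv := isPauliMultiple_pauliOp v
    rw [smul_mul_assoc, smul_mul_smul_comm]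
    have h1' : ∀ s, pauliOp v * pauliOp a = s → ∀ M, pauliOp v * (pauliOp a * M) = s * M :=
      fun s hs M => by rw [← mul_assoc, hs]
    -- The image of a Pauli operator depends only on whether it commutes with `A` and with `B`.
    rcases pauliOp_commute_or v a with h1 | h1 <;> rcases pauliOp_commute_or v b with h2 | h2
    · convert hv using 1
      simp only [mul_add, add_mul, mul_sub, sub_mul, one_mul, mul_one, mul_assoc, h1' _ h1, h1, h2,
        hA', hB', hab']
      module
    · convert ha.mul hv using 1
      simp only [mul_add, add_mul, mul_sub, sub_mul, one_mul, mul_one, mul_assoc, h1' _ h1, h1, h2,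
        hA', hB', hab', mul_neg]
      module
    · convert hb.mul hv using 1
      simp only [mul_add, add_mul, mul_sub, sub_mul, one_mul, mul_one, mul_assoc, h1' _ h1, h1, h2,
        hA', hB', hab', mul_neg, neg_mul]
      module
    · convert ((ha.mul hb).mul hv).neg using 1
      simp only [mul_add, add_mul, mul_sub, sub_mul, one_mul, mul_one, mul_assoc, h1' _ h1, h1, h2,
        hA', hB', hab', mul_neg, neg_mul]
      module

/-- Clifford error-detection supermaps are closed under composition. -/
theorem IsCliffordDetectionSupermap.comp {n : ℕ} {Θ Θ' : Superop (Fin n) → Superop (Fin n)}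
    (h : IsCliffordDetectionSupermap Θ) (h' : IsCliffordDetectionSupermap Θ') :
    IsCliffordDetectionSupermap (Θ ∘ Θ') := by
  obtain ⟨m, UE, UD, hUE, hUD, rfl⟩ := h
  obtain ⟨k, VE, VD, hVE, hVD, rfl⟩ := h'
  have hL : ∀ {V : Op (Fin n ⊕ Fin k)}, IsClifford V → IsClifford (extendLeft (Fin m) V) :=
    fun hV => hV.tensorOp_one.relabelOp _
  have hR : ∀ {U : Op (Fin n ⊕ Fin m)}, IsClifford U → IsClifford (extendRight (Fin k) U) :=
    fun hU => hU.tensorOp_one.relabelOp _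
  refine ⟨k + m, _, _, ((hL hVE).mul (hR hUE)).relabelOp
    ((Equiv.refl (Fin n)).sumCongr finSumFinEquiv), ((hR hUD).mul (hL hVD)).relabelOp
    ((Equiv.refl (Fin n)).sumCongr finSumFinEquiv), ?_⟩
  exact detectionSupermap_comp ((compression_comp UE UD VE VD).trans
    (compression_relabel finSumFinEquiv _ _).symm)

theorem isCliffordDetectionSupermap_id {n : ℕ} :
    IsCliffordDetectionSupermap (id : Superop (Fin n) → Superop (Fin n)) :=
  ⟨0, 1, 1, .one, .one, detectionSupermap_one.symm⟩

end Clifford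

/-! ### Pauli symmetries and the symplectic complement -/

section Symmetries

variable {n : ℕ}

/-- The labels of the Pauli operators in `𝒬_H` include the linear span of the labels of the Pauli
support of `H`. -/
theorem pauliOp_mem_pauliSpan {H : Op (Fin n)} {v : Fin n → ZMod 2 × ZMod 2}
    (hv : v ∈ Submodule.span (ZMod 2) {u | (H * pauliOp u).trace ≠ 0}) :
    pauliOp v ∈ pauliSpan H := by
  refine ⟨pauliOp_mem v, ?_⟩
  induction hv using Submodule.span_induction with
  | mem u hu => exact ⟨[pauliOp u], 1, by simpa using ⟨pauliOp_mem u, hu⟩, by simp⟩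
  | zero => exact ⟨[], 1, by simp, by simp [pauliOp_zero]⟩
  | add u w _ _ hu hw =>
    obtain ⟨l, c, hl, hc⟩ := hu
    obtain ⟨l', c', hl', hc'⟩ := hw
    obtain ⟨k, hk, h⟩ := pauliOp_mul u w
    refine ⟨l ++ l', k⁻¹ * (c * c'), ?_, ?_⟩
    · simp only [List.mem_append]
      rintro R (hR | hR)
      exacts [hl R hR, hl' R hR]
    · rw [List.prod_append, mul_smul, ← smul_mul_smul_comm, ← hc, ← hc', h, smul_smul,
        inv_mul_cancel₀ hk, one_smul]
  | smul a u _ hu =>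
    rcases bit_cases a with rfl | rfl
    · exact ⟨[], 1, by simp, by simp [pauliOp_zero]⟩
    · rwa [one_smul]

/-- The symplectic form is non-degenerate: it represents every linear functional. -/
theorem exists_symplectic_representative
    (f : Module.Dual (ZMod 2) (Fin n → ZMod 2 × ZMod 2)) :
    ∃ q : Fin n → ZMod 2 × ZMod 2, ∀ u, f u = ∑ i, bitForm (u i) (q i) := by
  -- The coordinates are swapped, as the form pairs `X`-components with `Z`-components.
  refine ⟨fun i => (f (Pi.single i (0, 1)), f (Pi.single i (1, 0))), fun u => ?_⟩
  conv_lhs => rw [← Finset.univ_sum_single u, map_sum]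
  refine Finset.sum_congr rfl fun i _ => ?_
  have h : (Pi.single i (u i) : Fin n → ZMod 2 × ZMod 2) =
      (u i).1 • (Pi.single i (1, 0) : Fin n → ZMod 2 × ZMod 2) +
        (u i).2 • (Pi.single i (0, 1) : Fin n → ZMod 2 × ZMod 2) := by
    rw [← Pi.single_smul', ← Pi.single_smul', ← Pi.single_add]
    simp
  rw [h, map_add, map_smul, map_smul, bitForm, smul_eq_mul, smul_eq_mul]

theorem commute_of_support {H Q : Op (Fin n)}
    (h : ∀ v, (H * pauliOp v).trace ≠ 0 → pauliOp v * Q = Q * pauliOp v) : H * Q = Q * H := by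
  rw [pauliOp_expansion H, Finset.sum_mul, Finset.mul_sum]
  refine Finset.sum_congr rfl fun v _ => ?_
  by_cases hv : (H * pauliOp v).trace = 0
  · simp [hv]
  · simp only [Matrix.smul_mul, Matrix.mul_smul, h v hv]

/-- An error outside `𝒬_H` anticommutes with some Pauli symmetry of `H`: the symplectic double
complement of a subspace is the subspace itself. -/
theorem exists_symmetry_anticommuting {H P : Op (Fin n)} (hP : P ∈ paulis (Fin n))
    (h : P ∉ pauliSpan H) : ∃ Q ∈ pauliSymmetries H, P * Q ≠ Q * P := by
  obtain ⟨v, rfl⟩ := mem_paulis_iff.1 hP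
  obtain ⟨f, hfv, hf⟩ := Submodule.exists_le_ker_of_notMem (mt pauliOp_mem_pauliSpan h)
  obtain ⟨q, hq⟩ := exists_symplectic_representative f
  refine ⟨pauliOp q, ⟨pauliOp_mem q, commute_of_support fun u hu => ?_⟩, ?_⟩
  · have : f u = 0 := hf (Submodule.subset_span hu)
    rw [pauliOp_comm u q, ← hq, this]
    simp [bitSign]
  · intro hcomm
    have h1 := pauliOp_comm v q
    rw [← hq, (bit_cases _).resolve_left hfv, hcomm] at h1
    have h2 : pauliOp q * pauliOp v = 0 := by
      have h4 : (2 : ℂ) • (pauliOp q * pauliOp v) = 0 := by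
        rw [two_smul]
        nth_rewrite 1 [h1]
        simp [bitSign]
      exact (smul_eq_zero.1 h4).resolve_left two_ne_zero
    have h3 : pauliOp q * (pauliOp q * pauliOp v) = 0 := by rw [h2, mul_zero]
    rw [← mul_assoc, pauliOp_mul_self, one_mul] at h3
    exact pauliOp_ne_zero v h3

theorem mul_comm_of_mem_generatedPaulis {G : Set (Op (Fin n))} {P Q : Op (Fin n)}
    (hQ : Q ∈ generatedPaulis G) (h : ∀ R ∈ G, P * R = R * P) : P * Q = Q * P := by
  obtain ⟨-, l, c, hl, rfl⟩ := hQ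
  have : Commute P l.prod := Commute.list_prod_right _ _ fun R hR => h R (hl R hR)
  rw [Matrix.mul_smul, Matrix.smul_mul, this.eq]

theorem exists_isGeneratingList (S : Set (Op (Fin n))) (hS : S ⊆ paulis (Fin n)) :
    ∃ Qs, IsGeneratingList Qs S := by
  have hfin : S.Finite := by
    refine (Set.finite_range (pauliOp (ι := Fin n))).subset fun P hP => ?_
    obtain ⟨v, rfl⟩ := mem_paulis_iff.1 (hS hP)
    exact ⟨v, rfl⟩
  refine ⟨hfin.toFinset.toList, by simp, fun Q hQ => ⟨hS hQ, [Q], 1, ?_, by simp⟩⟩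
  simpa using hQ

end Symmetries

/-! ### The verification gadget -/

section Gadget

variable {n : ℕ}

theorem localOp_single_add (A B : Matrix (Fin 2) (Fin 2) ℂ) :
    localOp (fun _ : Fin 1 => A + B) = localOp (fun _ => A) + localOp fun _ => B := by
  ext x y; simp [localOp]

theorem localOp_single_smul (c : ℂ) (A : Matrix (Fin 2) (Fin 2) ℂ) :
    localOp (fun _ : Fin 1 => c • A) = c • localOp fun _ => A := by
  ext x y; simp [localOp]

theorem tensorOp_pauliOp_single (v : Fin n → ZMod 2 × ZMod 2) (a : ZMod 2 × ZMod 2) :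
    tensorOp (pauliOp v) (localOp fun _ : Fin 1 => bitPauli a) =
      pauliOp (Sum.elim v fun _ => a) := tensorOp_pauliOp v fun _ => a

theorem isClifford_hadamardAncilla : IsClifford (hadamardAncilla n) := by
  have h : hadamardAncilla n = ((Real.sqrt 2 : ℂ))⁻¹ • (pauliOp (Sum.elim 0 fun _ => (1, 0)) +
      pauliOp (Sum.elim 0 fun _ => (0, 1))) := by
    have hm : (!![1, 1; 1, -1] : Matrix (Fin 2) (Fin 2) ℂ) = bitPauli (1, 0) + bitPauli (0, 1) := by
      simp [bitPauli_x, bitPauli_z]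
    rw [hadamardAncilla, hm, localOp_single_smul, localOp_single_add, tensorOp_smul_right,
      tensorOp_add_right, ← pauliOp_zero, tensorOp_pauliOp_single, tensorOp_pauliOp_single]
  rw [h]
  refine isClifford_of_anticommute ?_
  rw [pauliOp_comm]
  simp [Fintype.sum_sum_type, bitForm, bitSign]

theorem isClifford_controlledOp (v : Fin n → ZMod 2 × ZMod 2) :
    IsClifford (controlledOp (pauliOp v)) := by
  have h0 : (!![1, 0; 0, 0] : Matrix (Fin 2) (Fin 2) ℂ) =
      (1 / 2 : ℂ) • bitPauli 0 + (1 / 2 : ℂ) • bitPauli (0, 1) := by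
    ext i j
    fin_cases i <;> fin_cases j <;> simp [bitPauli_zero, bitPauli_z]
    norm_num
  have h1 : (!![0, 0; 0, 1] : Matrix (Fin 2) (Fin 2) ℂ) =
      (1 / 2 : ℂ) • bitPauli 0 + (-1 / 2 : ℂ) • bitPauli (0, 1) := by
    ext i j
    fin_cases i <;> fin_cases j <;> simp [bitPauli_zero, bitPauli_z] <;> norm_num
  have hone : pauliOp (Sum.elim (0 : Fin n → ZMod 2 × ZMod 2) fun _ : Fin 1 => 0) = 1 := by
    rw [← pauliOp_zero]
    exact congrArg pauliOp (funext fun i => by cases i <;> rfl)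
  have hprod : pauliOp (Sum.elim v fun _ : Fin 1 => (0, 1)) =
      pauliOp (Sum.elim (0 : Fin n → ZMod 2 × ZMod 2) fun _ : Fin 1 => (0, 1)) *
        pauliOp (Sum.elim v fun _ : Fin 1 => 0) := by
    simp only [← tensorOp_pauliOp_single, tensorOp_mul, localOp_mul, bitPauli_zero, pauliOp_zero,
      one_mul, mul_one]
  have h : controlledOp (pauliOp v) = (1 / 2 : ℂ) • (1 + pauliOp (Sum.elim 0 fun _ => (0, 1)) +
      pauliOp (Sum.elim v fun _ => 0) - pauliOp (Sum.elim 0 fun _ => (0, 1)) *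
        pauliOp (Sum.elim v fun _ => 0)) := by
    rw [controlledOp, h0, h1, ← hprod, ← hone, ← pauliOp_zero]
    simp only [localOp_single_add, localOp_single_smul, tensorOp_add_right, tensorOp_smul_right,
      tensorOp_pauliOp_single]
    module
  rw [h]
  refine isClifford_of_commute ?_
  rw [pauliOp_comm]
  simp [Fintype.sum_sum_type, bitForm, bitSign]

theorem pauli_conjTranspose {Q : Op (Fin n)} (hQ : Q ∈ paulis (Fin n)) : Qᴴ = Q := by
  obtain ⟨v, rfl⟩ := mem_paulis_iff.1 hQ
  exact pauliOp_conjTranspose v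

theorem pauli_mul_self {Q : Op (Fin n)} (hQ : Q ∈ paulis (Fin n)) : Q * Q = 1 := by
  obtain ⟨v, rfl⟩ := mem_paulis_iff.1 hQ
  exact pauliOp_mul_self v

theorem isCliffordDetectionSupermap_scvGadgetOne {Q : Op (Fin n)} (hQ : Q ∈ paulis (Fin n)) :
    IsCliffordDetectionSupermap (scvGadgetOne Q) := by
  refine ⟨1, _, _, ?_, ?_, rfl⟩
  · obtain ⟨v, rfl⟩ := mem_paulis_iff.1 hQ
    exact (isClifford_controlledOp v).mul isClifford_hadamardAncilla
  · rw [pauli_conjTranspose hQ]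
    obtain ⟨v, rfl⟩ := mem_paulis_iff.1 hQ
    exact isClifford_hadamardAncilla.mul (isClifford_controlledOp v)

theorem isCliffordDetectionSupermap_scvGadget {Qs : List (Op (Fin n))}
    (h : ∀ Q ∈ Qs, Q ∈ paulis (Fin n)) : IsCliffordDetectionSupermap (scvGadget Qs) := by
  induction Qs with
  | nil => exact isCliffordDetectionSupermap_id
  | cons Q Qs ih =>
    exact (isCliffordDetectionSupermap_scvGadgetOne (h Q (by simp))).comp
      (ih fun R hR => h R (List.mem_cons_of_mem _ hR))

theorem postselectAncilla_tensorOp_single (A : Op (Fin n)) (B : Matrix (Fin 2) (Fin 2) ℂ) :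
    postselectAncilla (Fin n) (Fin 1) (tensorOp A (localOp fun _ => B)) = B 0 0 • A := by
  ext x y
  change A x y * localOp (fun _ => B) (fun _ => 0) (fun _ => 0) = B 0 0 * A x y
  simp [localOp, mul_comm]

/-- The gadget of a Pauli symmetry `Q` averages Kraus operators over conjugation by `1` and `Q`. -/
theorem compression_scvGadgetOne {Q : Op (Fin n)} (hQ : Q ∈ paulis (Fin n)) (A : Op (Fin n)) :
    compression (controlledOp Q * hadamardAncilla n) (hadamardAncilla n * controlledOp Qᴴ) A =
      (1 / 2 : ℂ) • (A + Q * A * Q) := by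
  have hmid : hadamardAncilla n * controlledOp Qᴴ * tensorOp A 1 *
      (controlledOp Q * hadamardAncilla n) = hadamardAncilla n *
        (tensorOp A (localOp fun _ => !![1, 0; 0, 0]) +
          tensorOp (Q * A * Q) (localOp fun _ => !![0, 0; 0, 1])) * hadamardAncilla n := by
    have h : controlledOp Qᴴ * tensorOp A 1 * controlledOp Q =
        tensorOp A (localOp fun _ => !![1, 0; 0, 0]) +
          tensorOp (Q * A * Q) (localOp fun _ => !![0, 0; 0, 1]) := by
      have hz : localOp (fun _ : Fin 1 => (0 : Matrix (Fin 2) (Fin 2) ℂ)) = 0 := by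
        ext x y; simp [localOp]
      have hz' : ∀ B : Op (Fin n), tensorOp B (0 : Op (Fin 1)) = 0 := fun B => by
        ext x y; simp [tensorOp]
      have h00 : (!![1, 0; 0, 0] : Matrix (Fin 2) (Fin 2) ℂ) * !![1, 0; 0, 0] = !![1, 0; 0, 0] := by
        ext i j; fin_cases i <;> fin_cases j <;> simp
      have h11 : (!![0, 0; 0, 1] : Matrix (Fin 2) (Fin 2) ℂ) * !![0, 0; 0, 1] = !![0, 0; 0, 1] := by
        ext i j; fin_cases i <;> fin_cases j <;> simp
      have h01 : (!![1, 0; 0, 0] : Matrix (Fin 2) (Fin 2) ℂ) * !![0, 0; 0, 1] = 0 := by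
        ext i j; fin_cases i <;> fin_cases j <;> simp
      have h10 : (!![0, 0; 0, 1] : Matrix (Fin 2) (Fin 2) ℂ) * !![1, 0; 0, 0] = 0 := by
        ext i j; fin_cases i <;> fin_cases j <;> simp
      rw [pauli_conjTranspose hQ]
      simp only [controlledOp, add_mul, mul_add, tensorOp_mul, localOp_mul, one_mul, mul_one, h00,
        h01, h10, h11, hz, hz', add_zero, zero_add]
    rw [← h]
    simp only [mul_assoc]
  rw [compression, hmid]
  simp only [hadamardAncilla, mul_add, add_mul, tensorOp_mul, localOp_mul, one_mul, mul_one,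
    map_add, postselectAncilla_tensorOp_single, smul_mul_assoc, mul_smul_comm, smul_smul,
    inv_sqrt_two_mul_self]
  simp

/-- Concatenated gadgets of Pauli symmetries keep an evolution composed with a Pauli error if the
error commutes with all of the symmetries, and annihilate it otherwise. -/
theorem scvGadget_unitaryChannel {V P : Op (Fin n)} (hP : P ∈ paulis (Fin n))
    {Qs : List (Op (Fin n))} (hQs : ∀ Q ∈ Qs, Q ∈ paulis (Fin n) ∧ Commute V Q) :
    ((∀ Q ∈ Qs, P * Q = Q * P) → scvGadget Qs (unitaryChannel (P * V)) = unitaryChannel (P * V)) ∧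
      ((∃ Q ∈ Qs, P * Q ≠ Q * P) → scvGadget Qs (unitaryChannel (P * V)) = 0) := by
  have hzero : (0 : Superop (Fin n)) = unitaryChannel 0 :=
    LinearMap.ext fun ρ => by simp [unitaryChannel_apply]
  induction Qs with
  | nil => simp [scvGadget]
  | cons Q Qs ih =>
    obtain ⟨ih1, ih2⟩ := ih fun R hR => hQs R (List.mem_cons_of_mem _ hR)
    obtain ⟨hQ, hVQ⟩ := hQs Q (by simp)
    have hQQ := pauli_mul_self hQ
    have hone : ∀ A, scvGadgetOne Q (unitaryChannel A) =
        unitaryChannel ((1 / 2 : ℂ) • (A + Q * A * Q)) := fun A => by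
      rw [scvGadgetOne, detectionSupermap_unitaryChannel, compression_scvGadgetOne hQ]
    have hconj : ∀ R, Q * P = R * Q → Q * (P * V) * Q = R * V := fun R hR => by
      rw [← mul_assoc, hR, mul_assoc, mul_assoc, hVQ.eq, ← mul_assoc Q, hQQ, one_mul]
    constructor
    · intro h
      rw [scvGadget, ih1 fun R hR => h R (List.mem_cons_of_mem _ hR), hone,
        hconj P (h Q (by simp)).symm]
      congr 1
      module
    · intro h
      by_cases h' : ∃ R ∈ Qs, P * R ≠ R * P
      · rw [scvGadget, ih2 h', hzero, hone]
        simp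
      · push Not at h'
        have hanti : Q * P = (-P) * Q := by
          obtain ⟨R, hR, hPR⟩ := h
          rcases List.mem_cons.1 hR with rfl | hR
          · obtain ⟨u, rfl⟩ := mem_paulis_iff.1 hP
            obtain ⟨v, rfl⟩ := mem_paulis_iff.1 hQ
            rw [neg_mul]
            exact (pauliOp_commute_or v u).resolve_left fun h => hPR h.symm
          · exact absurd (h' R hR) hPR
        rw [scvGadget, ih1 h', hone, hconj _ hanti, hzero]
        simp

theorem errorChannel_comp_evolution {P H : Op (Fin n)} (hP : P ∈ paulis (Fin n)) (θ : ℝ) :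
    errorChannel P ∘ₗ evolution H θ =
      unitaryChannel (P * NormedSpace.exp ((Complex.I * (θ : ℂ)) • H)) := by
  refine LinearMap.ext fun ρ => ?_
  rw [unitaryChannel_apply, Matrix.conjTranspose_mul, pauli_conjTranspose hP]
  change P * (_ * ρ * _) * P = _
  simp only [mul_assoc]

/-- The gadgets of generators of the Pauli symmetries of `H` detect all Pauli errors outside
`𝒬_H`. -/
theorem detects_scvGadget {K : ℕ} {H : Op (Fin n)} {N : PauliNoise n K}
    (hN : N.errors ∩ pauliSpan H = ∅) {Qs : List (Op (Fin n))}
    (hQs : IsGeneratingList Qs (pauliSymmetries H)) : Detects (scvGadget Qs) H N := by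
  intro i θ
  have hcomm : ∀ Q ∈ Qs, Q ∈ paulis (Fin n) ∧
      Commute (NormedSpace.exp ((Complex.I * (θ : ℂ)) • H)) Q := fun Q hQ =>
    ⟨(hQs.1 Q hQ).1, Commute.exp_left (Commute.smul_left (hQs.1 Q hQ).2 _)⟩
  rw [errorChannel_comp_evolution (N.err_mem i)]
  obtain ⟨h1, h2⟩ := scvGadget_unitaryChannel (N.err_mem i) hcomm
  split_ifs with hi
  · subst hi
    rw [h1 fun Q _ => by rw [N.err_zero, one_mul, mul_one], N.err_zero, one_mul, one_smul]
    rfl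
  · have hPi : N.err i ∉ pauliSpan H := fun hmem =>
      (Set.eq_empty_iff_forall_notMem.1 hN) _ ⟨⟨i, hi, rfl⟩, hmem⟩
    obtain ⟨Q, hQ, hPQ⟩ := exists_symmetry_anticommuting (N.err_mem i) hPi
    rw [h2, zero_smul]
    by_contra! h
    exact hPQ (mul_comm_of_mem_generatedPaulis (hQs.2 hQ) h)

end Gadget

/-! ### Errors that cannot be detected -/

section Derivative

open scoped Matrix.Norms.Operator

variable {n : ℕ}

/-- If `exp (-θX) K(exp (θX))` is central for all `θ`, then so is its derivative at `θ = 0`. -/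
theorem commute_of_forall_exp_commute (K : Op (Fin n) →ₗ[ℂ] Op (Fin n)) (X : Op (Fin n))
    (h : ∀ (θ : ℝ) (B : Op (Fin n)),
      Commute (NormedSpace.exp (θ • -X) * K (NormedSpace.exp (θ • X))) B)
    (B : Op (Fin n)) : Commute (K X - X * K 1) B := by
  have h1 : HasDerivAt (fun θ : ℝ => NormedSpace.exp (θ • -X)) (-X) 0 := by
    have h := hasDerivAt_exp_smul_const (𝕂 := ℝ) (-X) 0
    rw [zero_smul, NormedSpace.exp_zero, one_mul] at h
    exact h
  have h2 : HasDerivAt (fun θ : ℝ => NormedSpace.exp (θ • X)) X 0 := by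
    have h := hasDerivAt_exp_smul_const (𝕂 := ℝ) X 0
    rw [zero_smul, NormedSpace.exp_zero, one_mul] at h
    exact h
  have h3 : HasDerivAt (fun θ : ℝ => K (NormedSpace.exp (θ • X))) (K X) 0 :=
    ((K.restrictScalars ℝ).toContinuousLinearMap.hasFDerivAt.comp_hasDerivAt (0 : ℝ) h2 :)
  have h4 := h1.mul h3
  have h5 := (h4.mul_const B).sub (h4.const_mul B)
  have h6 : HasDerivAt (fun _ : ℝ => (0 : Op (Fin n))) 0 (0 : ℝ) := hasDerivAt_const _ _
  have h7 := h5.unique (h6.congr_of_eventuallyEq (Filter.Eventually.of_forall fun θ => by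
    exact sub_eq_zero.2 (h θ B)))
  simp only [zero_smul, NormedSpace.exp_zero, one_mul, neg_mul, neg_add_eq_sub] at h7
  exact sub_eq_zero.1 h7

end Derivative

section Necessity

open scoped ComplexOrder

variable {ι κ : Type} [Fintype ι] [DecidableEq ι] [Fintype κ] [DecidableEq κ]

/-- The map `A ↦ ⟨0⋯0| U_D (A ⊗ 1) U_E |0⋯0⟩` is linear. -/
def compressionLinear (UE UD : Op (ι ⊕ κ)) : Op ι →ₗ[ℂ] Op ι where
  toFun := compression UE UD
  map_add' A B := by simp [compression, tensorOp_add_left, mul_add, add_mul]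
  map_smul' c A := by simp [compression, tensorOp_smul_left]

/-- A matrix that conjugates like an invertible `V` differs from `V` by a central unitary. -/
theorem central_of_unitaryChannel_eq {A V W : Op ι} (hWV : W * V = 1)
    (h : unitaryChannel A = unitaryChannel V) :
    (W * A) * (W * A)ᴴ = 1 ∧ ∀ B, Commute (W * A) B := by
  have hVW : Vᴴ * Wᴴ = 1 := by rw [← Matrix.conjTranspose_mul, hWV, Matrix.conjTranspose_one]
  have key : ∀ B, (W * A) * B * (W * A)ᴴ = B := fun B => by
    have hB : A * B * Aᴴ = V * B * Vᴴ := LinearMap.congr_fun h B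
    calc _ = W * (A * B * Aᴴ) * Wᴴ := by
          rw [Matrix.conjTranspose_mul]; simp only [Matrix.mul_assoc]
      _ = (W * V) * B * (Vᴴ * Wᴴ) := by rw [hB]; simp only [Matrix.mul_assoc]
      _ = B := by rw [hWV, hVW, one_mul, mul_one]
  have h1 : (W * A) * (W * A)ᴴ = 1 := by simpa using key 1
  refine ⟨h1, fun B => ?_⟩
  have h2 : (W * A)ᴴ * (W * A) = 1 := mul_eq_one_comm.1 h1
  calc (W * A) * B = (W * A) * B * ((W * A)ᴴ * (W * A)) := by rw [h2, mul_one]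
    _ = ((W * A) * B * (W * A)ᴴ) * (W * A) := by simp only [Matrix.mul_assoc]
    _ = B * (W * A) := by rw [key B]

theorem exists_smul_one_of_central {M : Op ι} (h : ∀ B, Commute M B) :
    ∃ c : ℂ, M = c • (1 : Op ι) := by
  obtain ⟨c, hc⟩ := Matrix.mem_range_scalar_of_commute_single fun i j _ => (h (single i j 1)).symm
  exact ⟨c, by rw [← hc, Matrix.scalar_apply, Matrix.smul_one_eq_diagonal]⟩

/-- A unitary whose `|0⋯0⟩`-block is a phase `ω` acts on the whole code space as that phase,
since no weight is left outside of the block. -/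
theorem mul_ancillaIsometry_of_block {W : Op (ι ⊕ κ)} {ω : ℂ} (hW : Wᴴ * W = 1)
    (hω : star ω * ω = 1) (h : (ancillaIsometry ι κ)ᴴ * W * ancillaIsometry ι κ = ω • 1) :
    W * ancillaIsometry ι κ = ω • ancillaIsometry ι κ := by
  set J := ancillaIsometry ι κ with hJ
  have h' : Jᴴ * Wᴴ * J = star ω • 1 := by
    have := congrArg Matrix.conjTranspose h
    simpa [Matrix.conjTranspose_mul, Matrix.mul_assoc] using this
  have hJJ : Jᴴ * J = 1 := ancillaIsometry_isometry
  have h1 : Jᴴ * Wᴴ * (W * J) = 1 := by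
    rw [Matrix.mul_assoc, ← Matrix.mul_assoc Wᴴ, hW, Matrix.one_mul, hJJ]
  -- `W J - ω J` has vanishing Gram matrix.
  rw [← sub_eq_zero, ← Matrix.conjTranspose_mul_self_eq_zero]
  rw [Matrix.conjTranspose_sub, Matrix.conjTranspose_mul, Matrix.conjTranspose_smul,
    Matrix.sub_mul, Matrix.mul_sub, Matrix.mul_sub, h1, Matrix.mul_smul, h', Matrix.smul_mul,
    ← Matrix.mul_assoc, h, Matrix.smul_mul, Matrix.mul_smul, hJJ, smul_smul, smul_smul, mul_comm ω,
    hω]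
  simp

theorem compression_eq_smul {UE UD : Op (ι ⊕ κ)} {ω : ℂ} (hUD : UDᴴ * UD = 1)
    (h : UD * UE * ancillaIsometry ι κ = ω • ancillaIsometry ι κ) (A : Op ι) :
    compression UE UD A = ω • compression UDᴴ UD A := by
  rw [compression, compression, postselectAncilla_eq, postselectAncilla_eq]
  calc _ = (ancillaIsometry ι κ)ᴴ * (UD * tensorOp A 1 * (UDᴴ * UD) * UE) *
        ancillaIsometry ι κ := by rw [hUD, mul_one]
    _ = (ancillaIsometry ι κ)ᴴ * (UD * tensorOp A 1 * UDᴴ) *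
        (UD * UE * ancillaIsometry ι κ) := by simp only [Matrix.mul_assoc]
    _ = _ := by rw [h, Matrix.mul_smul]

theorem pauliOp_column_zero {q : κ → ZMod 2 × ZMod 2} (h : pauliOp q 0 0 ≠ 0) {x : κ → Fin 2}
    (hx : x ≠ 0) : pauliOp q x 0 = 0 := by
  obtain ⟨j, hj⟩ := Function.ne_iff.1 hx
  have h0 : bitPauli (q j) 0 0 ≠ 0 := Finset.prod_ne_zero_iff.1 h j (Finset.mem_univ j)
  have hxj : x j = 1 := by
    have := hj
    simp only [Pi.zero_apply] at this
    omega
  refine Finset.prod_eq_zero (Finset.mem_univ j) ?_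
  rw [hxj]
  exact bitPauli_one_zero _ h0

/-- After decoding, a Pauli operator acts on the code space as a multiple of a Pauli operator; if
the multiple does not vanish, the decoded operator preserves the code space. -/
theorem compression_pauliOp {UD : Op (ι ⊕ κ)} (hUD : IsClifford UD) (v : ι → ZMod 2 × ZMod 2) :
    ∃ (c : ℂ) (p : ι → ZMod 2 × ZMod 2), compression UDᴴ UD (pauliOp v) = c • pauliOp p ∧
      (c ≠ 0 → UD * tensorOp (pauliOp v) 1 * UDᴴ * ancillaIsometry ι κ =
        ancillaIsometry ι κ * (c • pauliOp p)) := by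
  obtain ⟨c, w, hc⟩ := hUD.isPauliMultiple (Sum.elim v 0)
  rw [← tensorOp_pauliOp, pauliOp_zero, pauliOp_sum w] at hc
  set p := w ∘ Sum.inl
  set q := w ∘ Sum.inr
  refine ⟨c * pauliOp q 0 0, p, ?_, fun h0 => ?_⟩
  · rw [compression, hc]
    ext x y
    change c * (pauliOp p x y * pauliOp q 0 0) = c * pauliOp q 0 0 * pauliOp p x y
    ring
  · rw [hc]
    ext u y
    rw [mul_ancillaIsometry_apply, ancillaIsometry_mul_apply]
    change c * (pauliOp p _ y * pauliOp q _ 0) = _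
    split_ifs with hu
    · rw [hu]
      change _ = c * pauliOp q 0 0 * pauliOp p _ y
      ring
    · rw [pauliOp_column_zero (right_ne_zero_of_mul h0) hu, mul_zero, mul_zero]

/-- The operators that the decoder maps to operators acting invertibly on the code space. -/
def PreservesCode (UD : Op (ι ⊕ κ)) (A : Op ι) : Prop :=
  ∃ B : Op ι, IsUnit B ∧ UD * tensorOp A 1 * UDᴴ * ancillaIsometry ι κ = ancillaIsometry ι κ * B

theorem PreservesCode.list_prod {UD : Op (ι ⊕ κ)} (hUD : UDᴴ * UD = 1) {l : List (Op ι)}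
    (h : ∀ R ∈ l, PreservesCode UD R) : PreservesCode UD l.prod := by
  induction l with
  | nil =>
    refine ⟨1, isUnit_one, ?_⟩
    rw [List.prod_nil, tensorOp_one, mul_one, mul_eq_one_comm.1 hUD, Matrix.one_mul, Matrix.mul_one]
  | cons R l ih =>
    obtain ⟨B, hB, hRB⟩ := h R (by simp)
    obtain ⟨C, hC, hlC⟩ := ih fun S hS => h S (List.mem_cons_of_mem _ hS)
    refine ⟨B * C, hB.mul hC, ?_⟩
    have hmul : tensorOp (R * l.prod) (1 : Op κ) =
        tensorOp R 1 * (UDᴴ * UD) * tensorOp l.prod 1 := by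
      rw [hUD, mul_one, tensorOp_mul, mul_one]
    calc _ = (UD * tensorOp R 1 * UDᴴ) *
          (UD * tensorOp l.prod 1 * UDᴴ * ancillaIsometry ι κ) := by
            rw [List.prod_cons, hmul]; simp only [Matrix.mul_assoc]
      _ = _ := by rw [hlC, ← Matrix.mul_assoc, hRB, Matrix.mul_assoc]

theorem PreservesCode.compression_ne_zero {UD : Op (ι ⊕ κ)} {A : Op ι} (h : PreservesCode UD A) :
    compression UDᴴ UD A ≠ 0 := by
  obtain ⟨B, hB, hAB⟩ := h
  rw [compression, postselectAncilla_eq, Matrix.mul_assoc, hAB, ← Matrix.mul_assoc,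
    ancillaIsometry_isometry, Matrix.one_mul]
  exact hB.ne_zero

/-- If the compression `L` fixes `H` up to the identity, it annihilates no Pauli operator in the
support of `H`: each Pauli operator contributes at most one Pauli operator to `L(H)`, and every
non-identity element of the support of `H` has to be produced. -/
theorem compression_ne_zero_of_support {UD : Op (ι ⊕ κ)} (hUD : IsClifford UD) {H : Op ι}
    (hH : ∀ u, u ≠ 0 → (compression UDᴴ UD H * pauliOp u).trace = (H * pauliOp u).trace)
    {v : ι → ZMod 2 × ZMod 2} (hv : (H * pauliOp v).trace ≠ 0) :
    compression UDᴴ UD (pauliOp v) ≠ 0 := by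
  have hone : compression UDᴴ UD (pauliOp 0) = 1 := by
    rw [compression, pauliOp_zero, tensorOp_one, mul_one, ← Matrix.star_eq_conjTranspose,
      Matrix.mem_unitaryGroup_iff.1 hUD.1,
      postselectAncilla_eq, Matrix.mul_one, ancillaIsometry_isometry]
  rcases eq_or_ne v 0 with rfl | hv0
  · rw [hone]
    exact one_ne_zero
  -- Each `u` in the support is produced by some `w` in the support; this choice is injective,
  -- hence surjective, so every element of the support produces something.
  have hex : ∀ u : {u : ι → ZMod 2 × ZMod 2 // u ≠ 0 ∧ (H * pauliOp u).trace ≠ 0},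
      ∃ w : {u : ι → ZMod 2 × ZMod 2 // u ≠ 0 ∧ (H * pauliOp u).trace ≠ 0},
        (compression UDᴴ UD (pauliOp w.1) * pauliOp u.1).trace ≠ 0 := by
    rintro ⟨u, hu0, hu⟩
    have hL : compression UDᴴ UD H = ∑ w, ((2 : ℂ) ^ Fintype.card ι)⁻¹ •
        (H * pauliOp w).trace • compression UDᴴ UD (pauliOp w) := by
      change compressionLinear UDᴴ UD H = _
      conv_lhs => rw [pauliOp_expansion H]
      simp only [map_sum, map_smul]
      rfl
    have hne := hu
    rw [← hH u hu0, hL, Finset.sum_mul, Matrix.trace_sum] at hne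
    obtain ⟨w, -, hw⟩ := Finset.exists_ne_zero_of_sum_ne_zero hne
    rw [Matrix.smul_mul, Matrix.smul_mul, Matrix.trace_smul, Matrix.trace_smul, smul_eq_mul,
      smul_eq_mul] at hw
    have hw1 := left_ne_zero_of_mul (right_ne_zero_of_mul hw)
    have hw2 := right_ne_zero_of_mul (right_ne_zero_of_mul hw)
    refine ⟨⟨w, ?_, hw1⟩, hw2⟩
    rintro rfl
    rw [hone, one_mul, trace_pauliOp, if_neg hu0] at hw2
    exact hw2 rfl
  choose f hf using hex
  have hinj : Function.Injective f := by
    intro u u' huu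
    obtain ⟨c, p, hc, -⟩ := compression_pauliOp hUD (f u).1
    have key : ∀ z : ι → ZMod 2 × ZMod 2,
        (compression UDᴴ UD (pauliOp (f u).1) * pauliOp z).trace ≠ 0 → p = z := by
      intro z hz
      by_contra hpz
      exact hz (by rw [hc, Matrix.smul_mul, Matrix.trace_smul, trace_pauliOp_mul hpz, smul_zero])
    exact Subtype.ext ((key _ (hf u)).symm.trans (key _ (by rw [huu]; exact hf u')))
  obtain ⟨u, hu⟩ := Finite.surjective_of_injective hinj ⟨v, hv0, hv⟩
  intro h0
  have := hf u
  rw [hu, h0, zero_mul, Matrix.trace_zero] at this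
  exact this rfl

/-- A Clifford supermap that preserves the evolution does not annihilate any error in `𝒬_H`. -/
theorem compression_ne_zero_of_mem_pauliSpan {n : ℕ} {UE UD : Op (Fin n ⊕ κ)}
    (hUE : IsClifford UE) (hUD : IsClifford UD) {H : Op (Fin n)}
    (h : ∀ θ : ℝ, detectionSupermap UE UD (evolution H θ) = evolution H θ) {P : Op (Fin n)}
    (hP : P ∈ pauliSpan H) : compression UE UD P ≠ 0 := by
  have hUD1 : UDᴴ * UD = 1 := Matrix.mem_unitaryGroup_iff'.1 hUD.1
  have hexp : ∀ θ : ℝ, (Complex.I * (θ : ℂ)) • H = θ • (Complex.I • H) := fun θ => by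
    ext i j
    simp
    ring
  have hcentral := fun θ : ℝ => central_of_unitaryChannel_eq
    (A := compression UE UD (NormedSpace.exp (θ • (Complex.I • H))))
    (V := NormedSpace.exp (θ • (Complex.I • H)))
    (W := NormedSpace.exp (θ • -(Complex.I • H)))
    (by
      rw [← Matrix.exp_add_of_commute _ _ (by rw [smul_neg]; exact (Commute.refl _).neg_left),
        smul_neg, neg_add_cancel, NormedSpace.exp_zero])
    (by rw [← detectionSupermap_unitaryChannel, ← hexp]; exact h θ)
  obtain ⟨hK1, hK1c⟩ := hcentral 0
  simp only [zero_smul, NormedSpace.exp_zero, one_mul] at hK1 hK1c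
  obtain ⟨ω, hω⟩ := exists_smul_one_of_central hK1c
  have hωω : star ω * ω = 1 := by
    rw [hω, Matrix.conjTranspose_smul, Matrix.conjTranspose_one, smul_mul_smul_comm, mul_one] at hK1
    have := congrFun (congrFun hK1 0) 0
    rw [mul_comm]
    simpa using this
  have hω0 : ω ≠ 0 := right_ne_zero_of_mul (hωω ▸ one_ne_zero)
  have hblock : (ancillaIsometry (Fin n) κ)ᴴ * (UD * UE) * ancillaIsometry (Fin n) κ = ω • 1 := by
    rw [← hω, compression, tensorOp_one, mul_one, postselectAncilla_eq]
  have hW := mul_ancillaIsometry_of_block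
    (Matrix.mem_unitaryGroup_iff'.1 (mul_mem hUD.1 hUE.1)) hωω hblock
  have hKL := compression_eq_smul hUD1 hW
  obtain ⟨d, hd⟩ := exists_smul_one_of_central (commute_of_forall_exp_commute
    (compressionLinear UE UD) (Complex.I • H) fun θ => (hcentral θ).2)
  -- Here `u = 0` is the label of the identity, whose coefficient may change.
  have hLH : ∀ u, u ≠ 0 →
      (compression UDᴴ UD H * pauliOp u).trace = (H * pauliOp u).trace := by
    intro u hu
    rw [map_smul] at hd
    change Complex.I • compression UE UD H - Complex.I • H * compression UE UD 1 = _ at hd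
    rw [hω, hKL] at hd
    have ht := congrArg (fun M => (M * pauliOp u).trace) hd
    simp only [sub_mul, Matrix.trace_sub, Matrix.smul_mul, Matrix.mul_smul, mul_one, one_mul,
      Matrix.trace_smul, trace_pauliOp, if_neg hu, smul_eq_mul] at ht
    have hIω : Complex.I * ω ≠ 0 := mul_ne_zero Complex.I_ne_zero hω0
    refine mul_left_cancel₀ hIω ?_
    linear_combination ht
  obtain ⟨hPp, l, c, hl, hPl⟩ := hP
  have hgood : PreservesCode UD l.prod := by
    refine PreservesCode.list_prod hUD1 fun R hR => ?_
    obtain ⟨hRp, hRt⟩ := hl R hR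
    obtain ⟨v, rfl⟩ := mem_paulis_iff.1 hRp
    obtain ⟨a, p, ha, hap⟩ := compression_pauliOp hUD v
    have ha0 : a ≠ 0 := by
      rintro rfl
      exact compression_ne_zero_of_support hUD hLH hRt (by rw [ha, zero_smul])
    refine ⟨a • pauliOp p, ?_, hap ha0⟩
    exact IsUnit.of_mul_eq_one (a⁻¹ • pauliOp p) (by
      rw [smul_mul_smul_comm, mul_inv_cancel₀ ha0, pauliOp_mul_self, one_smul])
  have hc0 : c ≠ 0 := by
    rintro rfl
    obtain ⟨v, rfl⟩ := mem_paulis_iff.1 hPp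
    exact pauliOp_ne_zero v (by rw [hPl, zero_smul])
  have hLP : compression UDᴴ UD P = c • compression UDᴴ UD l.prod := by
    rw [hPl]
    exact map_smul (compressionLinear UDᴴ UD) c l.prod
  rw [hKL, hLP, smul_smul]
  exact smul_ne_zero (mul_ne_zero hω0 hc0) hgood.compression_ne_zero

/-- Errors in `𝒬_H` cannot be detected by a Clifford error-detection supermap. -/
theorem errors_inter_pauliSpan_eq_empty {n K : ℕ} {H : Op (Fin n)} {N : PauliNoise n K}
    {Θ : Superop (Fin n) → Superop (Fin n)} (hΘ : IsCliffordDetectionSupermap Θ)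
    (hdet : Detects Θ H N) : N.errors ∩ pauliSpan H = ∅ := by
  obtain ⟨m, UE, UD, hUE, hUD, rfl⟩ := hΘ
  refine Set.eq_empty_iff_forall_notMem.2 ?_
  rintro P ⟨⟨i, hi, rfl⟩, hP⟩
  refine compression_ne_zero_of_mem_pauliSpan hUE hUD (fun θ => ?_) hP ?_
  · have h := hdet 0 θ
    rw [if_pos rfl, one_smul, errorChannel_comp_evolution (N.err_mem 0), N.err_zero, one_mul] at h
    exact h
  · have h := hdet i 0
    rw [if_neg hi, zero_smul, errorChannel_comp_evolution (N.err_mem i),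
      detectionSupermap_unitaryChannel] at h
    simp only [Complex.ofReal_zero, mul_zero, zero_smul, NormedSpace.exp_zero, mul_one] at h
    have h1 := LinearMap.congr_fun h 1
    rw [unitaryChannel_apply, mul_one, LinearMap.zero_apply] at h1
    exact Matrix.self_mul_conjTranspose_eq_zero.1 h1

end Necessity

end SCV

end

theorem theorem3 (n K : ℕ) (H : SCV.Op (Fin n)) (hH : H.IsHermitian) (N : SCV.PauliNoise n K) :
    ((∃ Θ : SCV.Superop (Fin n) → SCV.Superop (Fin n),
        SCV.IsCliffordDetectionSupermap Θ ∧ SCV.Detects Θ H N) ↔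
      N.errors ∩ SCV.pauliSpan H = ∅) ∧
    (∀ Qs : List (SCV.Op (Fin n)), SCV.IsGeneratingList Qs (SCV.pauliSymmetries H) →
      SCV.IsCliffordDetectionSupermap (SCV.scvGadget Qs) ∧
      ((∃ Θ : SCV.Superop (Fin n) → SCV.Superop (Fin n),
          SCV.IsCliffordDetectionSupermap Θ ∧ SCV.Detects Θ H N) →
        SCV.Detects (SCV.scvGadget Qs) H N)) := by
  have hclifford : ∀ Qs, SCV.IsGeneratingList Qs (SCV.pauliSymmetries H) →
      SCV.IsCliffordDetectionSupermap (SCV.scvGadget Qs) := fun Qs hQs =>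
    SCV.isCliffordDetectionSupermap_scvGadget fun Q hQ => (hQs.1 Q hQ).1
  refine ⟨⟨?_, fun hN => ?_⟩, fun Qs hQs => ⟨hclifford Qs hQs, ?_⟩⟩
  · rintro ⟨Θ, hΘ, hdet⟩
    exact SCV.errors_inter_pauliSpan_eq_empty hΘ hdet
  · obtain ⟨Qs, hQs⟩ := SCV.exists_isGeneratingList (SCV.pauliSymmetries H) fun Q hQ => hQ.1
    exact ⟨_, hclifford Qs hQs, SCV.detects_scvGadget hN hQs⟩
  · rintro ⟨Θ, hΘ, hdet⟩
    exact SCV.detects_scvGadget (SCV.errors_inter_pauliSpan_eq_empty hΘ hdet) hQs
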